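/- Let $n\ge 3$ be odd and let $y_l=S(x_l)+\sigma_l\xi_l$, $x_l=l/n$, $1\le l\le n$, where $\xi_1,\dots,\xi_n$ are i.i.d. with ${\bf E}\xi_1=0$, ${\bf E}\xi_1^2=1$, ${\bf E}\xi_1^4=\xi^*<\infty$, and $\sigma_1,\dots,\sigma_n$ are positive random variables with $(\sigma_l)_{1\le l\le n}$ independent of $(\xi_l)_{1\le l\le n}$ and $\max_l\sigma_l^2\le\sigma_*$ for a constant $\sigma_*>0$. For $r>0$ let $W^1_r$ be the set of differentiable $1$-periodic functions $S:\mathbb R\to\mathbb R$ with $\int_0^1S^2(t)\,dt+\int_0^1(S'(t))^2\,dt\le r$. Let $\phi_1=1$ and, for $j\ge2$, $\phi_j(x)=\sqrt2\cos(2\pi[j/2]x)$ if $j$ is even and $\phi_j(x)=\sqrt2\sin(2\pi[j/2]x)$ if $j$ is odd; let $\|f\|_n^2=\frac1n\sum_{l=1}^nf^2(x_l)$ and $\widehat\theta_{j,n}=\frac1n\sum_{l=1}^ny_l\phi_j(x_l)$. Let $\Lambda=\Lambda_n\subset[0,1]^n$ be a finite nonempty set with $\nu=\nu_n$ elements, and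 for $\lambda\in\Lambda$ put $\widehat S_\lambda=\sum_{j=1}^n\lambda(j)\widehat\theta_{j,n}\phi_j$ and $|\lambda|^2=\sum_{j=1}^n\lambda^2(j)$. For an integer $1\le d_n\le n-1$ let $\widehat\varsigma_n=\sum_{j=d_n+1}^n\widehat\theta_{j,n}^2$, and for $\rho>0$ let $$J_n(\lambda)=\sum_{j=1}^n\lambda^2(j)\widehat\theta_{j,n}^2-2\sum_{j=1}^n\lambda(j)\Big(\widehat\theta_{j,n}^2-\frac{\widehat\varsigma_n}{n}\Big)+\rho\,\frac{|\lambda|^2\widehat\varsigma_n}{n},$$ let $\widehat\lambda$ be a (measurable) minimizer of $J_n$ over $\Lambda$, and let $\widehat S_*=\widehat S_{\widehat\lambda}$. Put $$v_n=\max_{\lambda\in\Lambda}\sum_{j=1}^n\lambda(j),\qquad u_{i,n}=\max_{\lambda\in\Lambda}\max_{1\le l\le n}\Big|\sum_{j=1}^n\lambda^i(j)(\phi_j^2(x_l)-1)\Big|\quad(i=1,2),$$ $$\Upsilon^*_n(\rho)=\frac{16\nu}{\rho}+4u_{1,n}\Big(1+\nu\frac{\sqrt{\xi^*}}{\sqrt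 n}\Big)+4\nu v_n\frac{\sqrt{\xi^*}}{\sqrt n},\qquad \Psi_n(\rho)=\frac{\rho(1-\rho)\Upsilon_n^*(\rho)+2\nu+2\rho^2(1-\rho)u_{2,n}}{\rho(1-3\rho)}\,\sigma_*,$$ $$\kappa(\rho)=\frac{4(1-\rho^2)}{1-3\rho},\qquad \varsigma_n^*(r)=\frac{4r\sqrt n}{d_n^2}+\frac{4\sqrt{r\sigma_*}}{d_n}+\frac{(2+d_n)\sigma_*}{\sqrt n},$$ $$D_n(\rho,r)=\Psi_n(\rho)+\kappa(\rho)\Big(2(\sqrt{\xi^*}+\sqrt2)\sigma_*+\varsigma_n^*(r)\Big)\frac{v_n}{\sqrt n}.$$ Then for every odd $n\ge3$, every $0<\rho<1/3$ and every $S\in W^1_r$, $${\bf E}_S\|\widehat S_*-S\|_n^2\le\frac{1+3\rho-2\rho^2}{1-3\rho}\min_{\lambda\in\Lambda}{\bf E}_S\|\widehat S_\lambda-S\|_n^2+\frac1nD_n(\rho,r),$$ all these risks being finite. Moreover, let $r,\sigma_*,\xi^*$ be fixed and let $n\to\infty$ along the odd integers. If $d_n/\sqrt n\to0$, $d_n^2/\sqrt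 n\to\infty$, $v_n=O(\sqrt n)$, and $\nu_n/n^\gamma\to0$, $u_{1,n}/n^\gamma\to0$, $u_{2,n}/n^\gamma\to0$ for every $\gamma>0$, then for every sequence $(\varrho_n)$ with $\varrho_n\to0$ and $n^\gamma\varrho_n\to+\infty$ for every $\gamma>0$, $$\lim_{n\to\infty}\ \sup_{\varrho_n\le\rho\le1/6}\frac{D_n(\rho,r)}{n^\gamma}=0\qquad\text{for every }\gamma>0.$$ -/

import Mathlib

open MeasureTheory ProbabilityTheory Filter Topology Set Asymptotics

noncomputable section

namespace HeteroReg

/-- The design point `x_l = l / n`. The index `l : Fin n` stands for `l + 1` in `{1, …, n}`. -/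
def design (n : ℕ) (l : Fin n) : ℝ := ((l : ℝ) + 1) / n

/-- The trigonometric basis `φ_j`, `j ≥ 1`: `φ_1 = 1`, and for `j ≥ 2` the function
`√2 cos (2π [j/2] x)` for even `j`, `√2 sin (2π [j/2] x)` for odd `j`.
(The value at `j = 0` is never used.) -/
def trigBasis (j : ℕ) (x : ℝ) : ℝ :=
  if j ≤ 1 then 1
  else if Even j then √2 * Real.cos (2 * Real.pi * ((j / 2 : ℕ) : ℝ) * x)
  else √2 * Real.sin (2 * Real.pi * ((j / 2 : ℕ) : ℝ) * x)

/-- The basis function belonging to the index `j : Fin n`, which stands for `j + 1`. -/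
def basisFn (n : ℕ) (j : Fin n) (x : ℝ) : ℝ := trigBasis ((j : ℕ) + 1) x

/-- The empirical squared norm `‖f‖_n² = n⁻¹ ∑_l f(x_l)²`. -/
def empNormSq (n : ℕ) (f : ℝ → ℝ) : ℝ := (1 / (n : ℝ)) * ∑ l, f (design n l) ^ 2

/-- The observations `y_l = S(x_l) + σ_l ξ_l`. -/
def obs {Ω : Type*} (n : ℕ) (S : ℝ → ℝ) (σ ξ : Fin n → Ω → ℝ) (ω : Ω) (l : Fin n) : ℝ :=
  S (design n l) + σ l ω * ξ l ω

/-- The empirical Fourier coefficients `θ̂_{j,n} = (Y, φ_j)_n`. -/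
def thetaHat (n : ℕ) (y : Fin n → ℝ) (j : Fin n) : ℝ :=
  (1 / (n : ℝ)) * ∑ l, y l * basisFn n j (design n l)

/-- The weighted least squares estimator `Ŝ_λ(x) = ∑_j λ(j) θ̂_{j,n} φ_j(x)`. -/
def wlsEst (n : ℕ) (y : Fin n → ℝ) (lam : Fin n → ℝ) (x : ℝ) : ℝ :=
  ∑ j, lam j * thetaHat n y j * basisFn n j x

/-- The loss `‖Ŝ_λ - S‖_n²`. -/
def loss (n : ℕ) (S : ℝ → ℝ) (y : Fin n → ℝ) (lam : Fin n → ℝ) : ℝ :=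
  empNormSq n (fun x => wlsEst n y lam x - S x)

/-- The tail-coefficient estimator `ς̂_n = ∑_{j = d + 1}^n θ̂_{j,n}²` of the integrated noise
variance. -/
def varEst (n d : ℕ) (y : Fin n → ℝ) : ℝ :=
  ∑ j ∈ Finset.univ.filter (fun j : Fin n => d + 1 ≤ (j : ℕ) + 1), thetaHat n y j ^ 2

/-- `θ̃_{j,n} = θ̂_{j,n}² - ς̂_n / n`. -/
def thetaTilde (n d : ℕ) (y : Fin n → ℝ) (j : Fin n) : ℝ :=
  thetaHat n y j ^ 2 - (1 / (n : ℝ)) * varEst n d y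

/-- The penalty `P̂_n(λ) = |λ|² ς̂_n / n`. -/
def penalty (n d : ℕ) (y : Fin n → ℝ) (lam : Fin n → ℝ) : ℝ :=
  (∑ j, lam j ^ 2) * varEst n d y / n

/-- The cost function
`J_n(λ) = ∑_j λ(j)² θ̂_{j,n}² - 2 ∑_j λ(j) θ̃_{j,n} + ρ P̂_n(λ)`. -/
def cost (n d : ℕ) (ρ : ℝ) (y : Fin n → ℝ) (lam : Fin n → ℝ) : ℝ :=
  ∑ j, lam j ^ 2 * thetaHat n y j ^ 2 - 2 * ∑ j, lam j * thetaTilde n d y j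
    + ρ * penalty n d y lam

/-- The assumptions on the noise: `ξ_1, …, ξ_n` are i.i.d. with `E ξ = 0`, `E ξ² = 1` and
`E ξ⁴ = ξs < ∞`; the volatilities `σ_1, …, σ_n` are positive random variables, jointly independent
of `(ξ_1, …, ξ_n)`, with `max_l σ_l² ≤ σs`. -/
structure NoiseModel {Ω : Type*} [MeasurableSpace Ω] (μ : Measure Ω) (n : ℕ)
    (σ ξ : Fin n → Ω → ℝ) (σs ξs : ℝ) : Prop where
  measurable_xi : ∀ l, Measurable (ξ l)
  measurable_sigma : ∀ l, Measurable (σ l)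
  indep_xi : iIndepFun ξ μ
  identDistrib_xi : ∀ k l, IdentDistrib (ξ k) (ξ l) μ μ
  memLp_xi : ∀ l, MemLp (ξ l) 4 μ
  mean_xi : ∀ l, ∫ ω, ξ l ω ∂μ = 0
  second_moment_xi : ∀ l, ∫ ω, ξ l ω ^ 2 ∂μ = 1
  fourth_moment_xi : ∀ l, ∫ ω, ξ l ω ^ 4 ∂μ = ξs
  indep_sigma_xi : IndepFun (fun ω l => σ l ω) (fun ω l => ξ l ω) μ
  sigma_pos : ∀ᵐ ω ∂μ, ∀ l, 0 < σ l ω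
  sigma_sq_le : ∀ᵐ ω ∂μ, ∀ l, σ l ω ^ 2 ≤ σs

/-- `W^k_r`: the `k` times differentiable 1-periodic functions `S : ℝ → ℝ` with
`∑_{j=0}^k ‖S^{(j)}‖² ≤ r`, where `‖f‖² = ∫_0^1 f(t)² dt`. -/
def sobolevBall (k : ℕ) (r : ℝ) : Set (ℝ → ℝ) :=
  {S | Function.Periodic S 1 ∧
    (∀ j < k, Differentiable ℝ (iteratedDeriv j S)) ∧
    (∀ j ≤ k, IntervalIntegrable (fun t => iteratedDeriv j S t ^ 2) volume 0 1) ∧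
    ∑ j ∈ Finset.range (k + 1), ∫ t in (0 : ℝ)..1, iteratedDeriv j S t ^ 2 ≤ r}

/-- `v_n = max_{λ ∈ Λ} ∑_j λ(j)`. -/
def vMax (n : ℕ) (Λ : Finset (Fin n → ℝ)) : ℝ := ⨆ lam : Λ, ∑ j, lam.1 j

/-- `u_{i,n} = max_{λ ∈ Λ} sup_{1 ≤ l ≤ n} |∑_j λ(j)^i (φ_j(x_l)² - 1)|`. -/
def uMax (i n : ℕ) (Λ : Finset (Fin n → ℝ)) : ℝ :=
  ⨆ lam : Λ, ⨆ l : Fin n, |∑ j, lam.1 j ^ i * (basisFn n j (design n l) ^ 2 - 1)|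

/-- `Υ*_n(ρ)`, with `ν` the cardinality of `Λ`. -/
def upsilonStar (n : ℕ) (Λ : Finset (Fin n → ℝ)) (ξs ρ : ℝ) : ℝ :=
  16 * (Λ.card : ℝ) / ρ
    + 4 * uMax 1 n Λ * (1 + (Λ.card : ℝ) * (√ξs / √(n : ℝ)))
    + 4 * (Λ.card : ℝ) * vMax n Λ * (√ξs / √(n : ℝ))

/-- `Ψ_n(ρ)`. -/
def psi (n : ℕ) (Λ : Finset (Fin n → ℝ)) (σs ξs ρ : ℝ) : ℝ :=
  (ρ * (1 - ρ) * upsilonStar n Λ ξs ρ + 2 * (Λ.card : ℝ)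
    + 2 * ρ ^ 2 * (1 - ρ) * uMax 2 n Λ) / (ρ * (1 - 3 * ρ)) * σs

/-- `κ(ρ) = 4 (1 - ρ²) / (1 - 3ρ)`. -/
def kappa (ρ : ℝ) : ℝ := 4 * (1 - ρ ^ 2) / (1 - 3 * ρ)

/-- `ς*_n(r) = 4 r √n / d² + 4 √(r σs) / d + (2 + d) σs / √n`. -/
def varStar (n d : ℕ) (σs r : ℝ) : ℝ :=
  4 * r * √(n : ℝ) / (d : ℝ) ^ 2 + 4 * √(r * σs) * (1 / (d : ℝ))
    + (2 + (d : ℝ)) * σs / √(n : ℝ)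

/-- The remainder
`D_n(ρ, r) = Ψ_n(ρ) + κ(ρ) (2 (√ξs + √2) σs + ς*_n(r)) v_n / √n`. -/
def remainder (n d : ℕ) (Λ : Finset (Fin n → ℝ)) (σs ξs ρ r : ℝ) : ℝ :=
  psi n Λ σs ξs ρ
    + kappa ρ * (2 * (√ξs + √2) * σs + varStar n d σs r) * (vMax n Λ / √(n : ℝ))

/-- `n → ∞` along the odd sample sizes. -/
def oddAtTop : Filter ℕ := atTop ⊓ 𝓟 {n | Odd n}

/-- The sequence `a` grows slower than every positive power of `n`. -/
def SlowlyGrowing (a : ℕ → ℝ) : Prop :=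
  ∀ γ : ℝ, 0 < γ → Tendsto (fun n : ℕ => a n / (n : ℝ) ^ γ) oddAtTop (𝓝 0)

/-- The sequence `ϱ` is slowly decreasing: `ϱ_n → 0` and `n^γ ϱ_n → +∞` for every `γ > 0`. -/
def SlowlyDecreasing (ϱ : ℕ → ℝ) : Prop :=
  Tendsto ϱ oddAtTop (𝓝 0) ∧
    ∀ γ : ℝ, 0 < γ → Tendsto (fun n : ℕ => (n : ℝ) ^ γ * ϱ n) oddAtTop atTop

end HeteroReg

end

open HeteroReg

noncomputable section

namespace HeteroReg

/-! ### The trigonometric basis on the design points -/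

/-! For odd `n` the first `n` trigonometric functions form an orthogonal basis of the functions on
the design points, so loss and cost are quadratic in the empirical coefficients. Let θ_j and η_j be
the coefficients of S and of the noise. Then loss minus cost is a term free of λ, minus ρ times the
penalty, plus twice the sum of the linear form Σ λ(j) θ_j η_j, an off-diagonal quadratic form in the
noise, centred diagonal forms, a deviation controlled by u_1, and a multiple of the error in
estimating the mean noise variance (`loss_eq_cost_add`). Comparing the minimizer with a fixed λ₀
removes the common term.

The minimizer is random, so these forms cannot simply be averaged at it. The linear and off-diagonal
forms are split by 2|Q| ≤ ρP + Q²/(ρP), where P dominates n E Q² up to a constant. The part ρP is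
absorbed, by the losses for the linear form and by the penalty for the off-diagonal one. The
quotient has mean O(1/(ρn)) for each fixed λ, and summing over Λ removes the dependence on the
minimizer at the price of a factor ν. The true penalty left at λ₀ has mean at most the risk of λ₀
plus u_2 σ_*/n. These absorptions produce the factor (1 + 3ρ - 2ρ²)/(1 - 3ρ) (`oracle_pathwise`,
`oracle_inequality`).

The variance estimator is accurate because the tail coefficients of S are small on the Sobolev ball:
a shift by one design step rotates each cosine-sine pair, and the increments of S are bounded by its
derivative (`sum_tail_thetaHat_sq_le`, `NoiseModel.integral_abs_meanVar_sub_varEst_le`).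

Moments are computed for frozen volatilities, with bounds uniform over their admissible values;
independence and Fubini then cover random ones. For the limit, D_n on ϱ_n ≤ ρ ≤ 1/6 is dominated by
sums and products of slowly growing sequences (`remainder_le`). -/

theorem sum_exp_design {n : ℕ} (m : ℤ) (hm0 : m ≠ 0) (hm : |m| < n) :
    ∑ l : Fin n, Complex.exp (((2 * Real.pi * m * design n l : ℝ) : ℂ) * Complex.I) = 0 := by
  have hn : 0 < n := by
    have := (abs_nonneg m).trans_lt hm
    exact_mod_cast this
  have hnC : (n : ℂ) ≠ 0 := by exact_mod_cast hn.ne'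
  set z : ℂ := Complex.exp (2 * Real.pi * Complex.I * (m / n)) with hz
  have hzn : z ^ n = 1 := by
    rw [hz, ← Complex.exp_nat_mul, Complex.exp_eq_one_iff]
    exact ⟨m, by field_simp⟩
  have hz1 : z ≠ 1 := by
    intro h
    rw [hz, Complex.exp_eq_one_iff] at h
    obtain ⟨k, hk⟩ := h
    have h2 : (2 * Real.pi * Complex.I : ℂ) ≠ 0 := Complex.two_pi_I_ne_zero
    rw [mul_comm (k : ℂ)] at hk
    have h3 := mul_left_cancel₀ h2 hk
    rw [div_eq_iff hnC] at h3
    have h4 : m = k * n := by exact_mod_cast h3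
    have : (n : ℤ) ∣ m := ⟨k, by rw [h4]; ring⟩
    exact hm0 (Int.eq_zero_of_abs_lt_dvd this hm)
  have hterm : ∀ l : Fin n,
      Complex.exp (((2 * Real.pi * m * design n l : ℝ) : ℂ) * Complex.I) = z * z ^ (l : ℕ) := by
    intro l
    rw [← pow_succ', hz, ← Complex.exp_nat_mul]
    congr 1
    simp only [design]
    push_cast
    ring
  rw [Finset.sum_congr rfl fun l _ => hterm l, ← Finset.mul_sum,
    Fin.sum_univ_eq_sum_range (fun l => z ^ l), geom_sum_eq hz1, hzn]
  simp

theorem sum_cos_design {n : ℕ} (m : ℤ) (hm0 : m ≠ 0) (hm : |m| < n) :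
    ∑ l : Fin n, Real.cos (2 * Real.pi * m * design n l) = 0 := by
  have h := congrArg Complex.re (sum_exp_design m hm0 hm)
  simpa only [Complex.re_sum, Complex.exp_ofReal_mul_I_re, Complex.zero_re] using h

theorem sum_sin_design {n : ℕ} (m : ℤ) (hm : |m| < n) :
    ∑ l : Fin n, Real.sin (2 * Real.pi * m * design n l) = 0 := by
  rcases eq_or_ne m 0 with rfl | hm0
  · simp
  have h := congrArg Complex.im (sum_exp_design m hm0 hm)
  simpa only [Complex.im_sum, Complex.exp_ofReal_mul_I_im, Complex.zero_im] using h

theorem trigBasis_one (x : ℝ) : trigBasis 1 x = 1 := by simp [trigBasis]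

theorem trigBasis_even (k : ℕ) (x : ℝ) :
    trigBasis (2 * k + 1 + 1) x = √2 * Real.cos (2 * Real.pi * ((k + 1 : ℕ) : ℝ) * x) := by
  have h1 : ¬ (2 * k + 1 + 1 ≤ 1) := by omega
  have h2 : Even (2 * k + 1 + 1) := ⟨k + 1, by ring⟩
  have h3 : (2 * k + 1 + 1) / 2 = k + 1 := by omega
  rw [trigBasis, if_neg h1, if_pos h2, h3]

theorem trigBasis_odd (k : ℕ) (x : ℝ) :
    trigBasis (2 * k + 2 + 1) x = √2 * Real.sin (2 * Real.pi * ((k + 1 : ℕ) : ℝ) * x) := by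
  have h1 : ¬ (2 * k + 2 + 1 ≤ 1) := by omega
  have h2 : ¬ Even (2 * k + 2 + 1) := by
    rw [Nat.not_even_iff_odd]
    exact ⟨k + 1, by ring⟩
  have h3 : (2 * k + 2 + 1) / 2 = k + 1 := by omega
  rw [trigBasis, if_neg h1, if_neg h2, h3]

theorem trigBasis_sq_le (j : ℕ) (x : ℝ) : trigBasis j x ^ 2 ≤ 2 := by
  have h2 : √(2 : ℝ) ^ 2 = 2 := Real.sq_sqrt (by norm_num)
  unfold trigBasis
  split_ifs
  · norm_num
  · rw [mul_pow, h2]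
    linarith [Real.cos_sq_le_one (2 * Real.pi * ((j / 2 : ℕ) : ℝ) * x)]
  · rw [mul_pow, h2]
    linarith [Real.sin_sq_le_one (2 * Real.pi * ((j / 2 : ℕ) : ℝ) * x)]

theorem nat_zero_or_odd_or_even (j : ℕ) : j = 0 ∨ (∃ k, j = 2 * k + 1) ∨ ∃ k, j = 2 * k + 2 := by
  rcases Nat.even_or_odd' j with ⟨k, rfl | rfl⟩
  · rcases k with _ | k
    · exact Or.inl rfl
    · exact Or.inr (Or.inr ⟨k, by ring⟩)
  · exact Or.inr (Or.inl ⟨k, rfl⟩)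

/-- Product-to-sum formulas leave frequencies a - b and a + b. Since a, b ≤ m, these stay below n =
2m + 1 in absolute value, so there is no aliasing. This is where odd n matters: for even n the last
cosine would have frequency n/2 and the wrong norm. -/
theorem sum_trigBasis_mul {m : ℕ} {i j : ℕ} (hi : i < 2 * m + 1) (hj : j < 2 * m + 1) :
    ∑ l : Fin (2 * m + 1), trigBasis (i + 1) (design (2 * m + 1) l)
      * trigBasis (j + 1) (design (2 * m + 1) l) = if i = j then ((2 * m + 1 : ℕ) : ℝ) else 0 := by
  have h2 : √(2 : ℝ) * √2 = 2 := Real.mul_self_sqrt (by norm_num)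
  set x := design (2 * m + 1)
  have cc : ∀ a b t : ℝ, √2 * Real.cos (2 * Real.pi * a * t) * (√2 * Real.cos (2 * Real.pi * b * t))
      = Real.cos (2 * Real.pi * (a - b) * t) + Real.cos (2 * Real.pi * (a + b) * t) := by
    intro a b t
    have e1 : 2 * Real.pi * (a - b) * t = 2 * Real.pi * a * t - 2 * Real.pi * b * t := by ring
    have e2 : 2 * Real.pi * (a + b) * t = 2 * Real.pi * a * t + 2 * Real.pi * b * t := by ring
    rw [e1, e2, Real.cos_sub, Real.cos_add]
    linear_combination (Real.cos (2 * Real.pi * a * t) * Real.cos (2 * Real.pi * b * t)) * h2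
  have ss : ∀ a b t : ℝ, √2 * Real.sin (2 * Real.pi * a * t) * (√2 * Real.sin (2 * Real.pi * b * t))
      = Real.cos (2 * Real.pi * (a - b) * t) - Real.cos (2 * Real.pi * (a + b) * t) := by
    intro a b t
    have e1 : 2 * Real.pi * (a - b) * t = 2 * Real.pi * a * t - 2 * Real.pi * b * t := by ring
    have e2 : 2 * Real.pi * (a + b) * t = 2 * Real.pi * a * t + 2 * Real.pi * b * t := by ring
    rw [e1, e2, Real.cos_sub, Real.cos_add]
    linear_combination (Real.sin (2 * Real.pi * a * t) * Real.sin (2 * Real.pi * b * t)) * h2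
  have sc : ∀ a b t : ℝ, √2 * Real.sin (2 * Real.pi * a * t) * (√2 * Real.cos (2 * Real.pi * b * t))
      = Real.sin (2 * Real.pi * (a - b) * t) + Real.sin (2 * Real.pi * (a + b) * t) := by
    intro a b t
    have e1 : 2 * Real.pi * (a - b) * t = 2 * Real.pi * a * t - 2 * Real.pi * b * t := by ring
    have e2 : 2 * Real.pi * (a + b) * t = 2 * Real.pi * a * t + 2 * Real.pi * b * t := by ring
    rw [e1, e2, Real.sin_sub, Real.sin_add]
    linear_combination (Real.sin (2 * Real.pi * a * t) * Real.cos (2 * Real.pi * b * t)) * h2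
  have C0 : ∀ a : ℤ, a ≠ 0 → |a| < ((2 * m + 1 : ℕ) : ℤ) →
      ∑ l, Real.cos (2 * Real.pi * a * x l) = 0 := fun a h h' => sum_cos_design a h h'
  have S0 : ∀ a : ℤ, |a| < ((2 * m + 1 : ℕ) : ℤ) →
      ∑ l, Real.sin (2 * Real.pi * a * x l) = 0 := fun a h' => sum_sin_design a h'
  have CC : ∀ a b : ℕ, a < m → b < m →
      ∑ l, (Real.cos (2 * Real.pi * (((a + 1 : ℕ) : ℝ) - ((b + 1 : ℕ) : ℝ)) * x l))
        = if a = b then ((2 * m + 1 : ℕ) : ℝ) else 0 := by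
    intro a b ha hb
    split_ifs with h
    · subst h; simp
    · have := C0 ((a : ℤ) - b) (by omega) (by rw [abs_lt]; constructor <;> omega)
      rw [← this]
      refine Finset.sum_congr rfl fun l _ => ?_
      push_cast
      congr 1
      ring
  have CP : ∀ a b : ℕ, a < m → b < m →
      ∑ l, (Real.cos (2 * Real.pi * (((a + 1 : ℕ) : ℝ) + ((b + 1 : ℕ) : ℝ)) * x l)) = 0 := by
    intro a b ha hb
    have := C0 ((a : ℤ) + b + 2) (by omega) (by rw [abs_lt]; constructor <;> omega)
    rw [← this]
    refine Finset.sum_congr rfl fun l _ => ?_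
    push_cast
    congr 1
    ring
  have SC : ∀ a b : ℕ, a < m → b < m →
      ∑ l, √2 * Real.sin (2 * Real.pi * ((a + 1 : ℕ) : ℝ) * x l)
        * (√2 * Real.cos (2 * Real.pi * ((b + 1 : ℕ) : ℝ) * x l)) = 0 := by
    intro a b ha hb
    simp only [sc, Finset.sum_add_distrib]
    have h1 := S0 ((a : ℤ) - b) (by rw [abs_lt]; constructor <;> omega)
    have h2 := S0 ((a : ℤ) + b + 2) (by rw [abs_lt]; constructor <;> omega)
    rw [← add_zero (0 : ℝ)]
    nth_rewrite 1 [← h1]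
    rw [← h2]
    congr 1 <;>
    · refine Finset.sum_congr rfl fun l _ => ?_
      push_cast
      congr 1
      ring
  have C1 : ∀ a : ℕ, a < m → ∑ l, √2 * Real.cos (2 * Real.pi * ((a + 1 : ℕ) : ℝ) * x l) = 0 := by
    intro a ha
    rw [← Finset.mul_sum]
    have h1 := C0 ((a : ℤ) + 1) (by omega) (by rw [abs_lt]; constructor <;> omega)
    push_cast at h1 ⊢
    rw [h1, mul_zero]
  have S1 : ∀ a : ℕ, a < m → ∑ l, √2 * Real.sin (2 * Real.pi * ((a + 1 : ℕ) : ℝ) * x l) = 0 := by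
    intro a ha
    rw [← Finset.mul_sum]
    have h1 := S0 ((a : ℤ) + 1) (by rw [abs_lt]; constructor <;> omega)
    push_cast at h1 ⊢
    rw [h1, mul_zero]
  rcases nat_zero_or_odd_or_even i with rfl | ⟨a, rfl⟩ | ⟨a, rfl⟩ <;>
  rcases nat_zero_or_odd_or_even j with rfl | ⟨b, rfl⟩ | ⟨b, rfl⟩
  · simp [trigBasis_one]
  · rw [if_neg (by omega)]
    simp only [zero_add, trigBasis_one, trigBasis_even, one_mul]
    exact C1 b (by omega)
  · rw [if_neg (by omega)]
    simp only [zero_add, trigBasis_one, trigBasis_odd, one_mul]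
    exact S1 b (by omega)
  · rw [if_neg (by omega)]
    simp only [zero_add, trigBasis_one, trigBasis_even, mul_one]
    exact C1 a (by omega)
  · simp only [trigBasis_even, cc, Finset.sum_add_distrib]
    rw [CC a b (by omega) (by omega), CP a b (by omega) (by omega), add_zero]
    simp
  · rw [if_neg (by omega)]
    simp only [trigBasis_even, trigBasis_odd]
    rw [← SC b a (by omega) (by omega)]
    exact Finset.sum_congr rfl fun l _ => mul_comm _ _
  · rw [if_neg (by omega)]
    simp only [zero_add, trigBasis_one, trigBasis_odd, mul_one]
    exact S1 a (by omega)
  · rw [if_neg (by omega)]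
    simp only [trigBasis_even, trigBasis_odd]
    exact SC a b (by omega) (by omega)
  · simp only [trigBasis_odd, ss, Finset.sum_sub_distrib]
    rw [CC a b (by omega) (by omega), CP a b (by omega) (by omega), sub_zero]
    simp

/-- The trigonometric basis is orthonormal for the empirical inner product. -/
theorem sum_basisFn_mul {n : ℕ} (hn : Odd n) (i j : Fin n) :
    ∑ l, basisFn n i (design n l) * basisFn n j (design n l) = if i = j then (n : ℝ) else 0 := by
  obtain ⟨m, rfl⟩ := hn
  have := sum_trigBasis_mul i.2 j.2
  simpa only [basisFn, Fin.ext_iff] using this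

/-- The trigonometric basis is complete on the design points. -/
theorem sum_basisFn_mul_design {n : ℕ} (hn : Odd n) (k l : Fin n) :
    ∑ j, basisFn n j (design n k) * basisFn n j (design n l) = if k = l then (n : ℝ) else 0 := by
  have hn0 : (n : ℝ) ≠ 0 := by exact_mod_cast hn.pos.ne'
  let A : Matrix (Fin n) (Fin n) ℝ := fun j l => basisFn n j (design n l)
  let B : Matrix (Fin n) (Fin n) ℝ := fun l j => basisFn n j (design n l) / n
  have h : A * B = 1 := by
    ext i j
    rw [Matrix.mul_apply, Matrix.one_apply]
    simp only [A, B, ← mul_div_assoc, ← Finset.sum_div, sum_basisFn_mul hn]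
    split_ifs <;> simp [hn0]
  -- A one-sided inverse of a square matrix is two-sided, so orthogonality of the n functions gives
  -- completeness on the n points.
  have h' : B * A = 1 := mul_eq_one_comm.mp h
  have h2 := congrFun (congrFun h' k) l
  rw [Matrix.mul_apply, Matrix.one_apply] at h2
  simp only [A, B, div_mul_eq_mul_div, ← Finset.sum_div] at h2
  rw [div_eq_iff hn0] at h2
  rw [h2]
  split_ifs <;> simp

theorem basisFn_sq_le (n : ℕ) (j : Fin n) (x : ℝ) : basisFn n j x ^ 2 ≤ 2 := trigBasis_sq_le _ _

theorem sum_thetaHat_mul_basisFn {n : ℕ} (hn : Odd n) (f : Fin n → ℝ) (k : Fin n) :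
    ∑ j, thetaHat n f j * basisFn n j (design n k) = f k := by
  have hn0 : (n : ℝ) ≠ 0 := by exact_mod_cast hn.pos.ne'
  simp only [thetaHat, mul_assoc, Finset.sum_mul, Finset.mul_sum]
  rw [Finset.sum_comm]
  simp only [← Finset.mul_sum, sum_basisFn_mul_design hn]
  simp
  field_simp

/-- Parseval's identity for the empirical inner product. -/
theorem sum_thetaHat_sq {n : ℕ} (hn : Odd n) (f : Fin n → ℝ) :
    ∑ j, thetaHat n f j ^ 2 = (1 / (n : ℝ)) * ∑ l, f l ^ 2 := by
  have h : ∀ j, thetaHat n f j ^ 2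
      = (1 / (n : ℝ)) * ∑ l, f l * (thetaHat n f j * basisFn n j (design n l)) := by
    intro j
    rw [sq]
    nth_rewrite 2 [thetaHat]
    rw [Finset.mul_sum, Finset.mul_sum, Finset.mul_sum]
    exact Finset.sum_congr rfl fun l _ => by ring
  rw [Finset.sum_congr rfl fun j _ => h j, ← Finset.mul_sum, Finset.sum_comm]
  simp only [← Finset.mul_sum, sum_thetaHat_mul_basisFn hn]
  simp only [sq]

theorem sum_combination_sq {n : ℕ} (hn : Odd n) (c : Fin n → ℝ) :
    ∑ l, (∑ j, c j * basisFn n j (design n l)) ^ 2 = n * ∑ j, c j ^ 2 := by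
  simp only [sq, Finset.sum_mul_sum]
  rw [Finset.sum_comm]
  have : ∀ i, ∑ l, ∑ j, c i * basisFn n i (design n l) * (c j * basisFn n j (design n l))
      = n * (c i * c i) := by
    intro i
    rw [Finset.sum_comm]
    have : ∀ j, ∑ l, c i * basisFn n i (design n l) * (c j * basisFn n j (design n l))
        = c i * c j * if i = j then (n : ℝ) else 0 := by
      intro j
      rw [← sum_basisFn_mul hn, Finset.mul_sum]
      exact Finset.sum_congr rfl fun l _ => by ring
    simp only [this]
    simp
    ring
  rw [Finset.mul_sum]
  exact Finset.sum_congr rfl fun i _ => this i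

/-! ### Decay of the empirical Fourier coefficients on the Sobolev ball -/

theorem sum_design_sub {n : ℕ} (hn : 0 < n) {G : ℝ → ℝ} (hG : Function.Periodic G 1) :
    ∑ l : Fin n, G (design n l - 1 / n) = ∑ l : Fin n, G (design n l) := by
  have hn0 : (n : ℝ) ≠ 0 := by exact_mod_cast hn.ne'
  have h1 : ∀ l : Fin n, G (design n l - 1 / n) = (fun l : ℕ => G ((l : ℝ) / n)) l := by
    intro l
    simp only [design]
    congr 1
    field_simp
    ring
  have h2 : ∀ l : Fin n, G (design n l) = (fun l : ℕ => G (((l + 1 : ℕ) : ℝ) / n)) l := by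
    intro l
    simp [design]
  rw [Finset.sum_congr rfl fun l _ => h1 l, Finset.sum_congr rfl fun l _ => h2 l,
    Fin.sum_univ_eq_sum_range (fun l : ℕ => G ((l : ℝ) / n)),
    Fin.sum_univ_eq_sum_range (fun l : ℕ => G (((l + 1 : ℕ) : ℝ) / n))]
  have h3 := Finset.sum_range_succ (fun l : ℕ => G ((l : ℝ) / n)) n
  have h4 := Finset.sum_range_succ' (fun l : ℕ => G ((l : ℝ) / n)) n
  have h5 : G ((n : ℝ) / n) = G (((0 : ℕ) : ℝ) / n) := by
    rw [div_self hn0, Nat.cast_zero, zero_div, ← hG 0, zero_add]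
  rw [h3, h5] at h4
  exact add_right_cancel h4

theorem sum_range_two_mul_add_one (f : ℕ → ℝ) (m : ℕ) :
    ∑ j ∈ Finset.range (2 * m + 1), f j
      = f 0 + ∑ k ∈ Finset.range m, (f (2 * k + 1) + f (2 * k + 2)) := by
  induction m with
  | zero => simp
  | succ m ih =>
    rw [show 2 * (m + 1) + 1 = 2 * m + 1 + 1 + 1 by ring, Finset.sum_range_succ,
      Finset.sum_range_succ, ih, Finset.sum_range_succ]
    ring_nf

theorem trigBasis_periodic (j : ℕ) : Function.Periodic (trigBasis j) 1 := by
  intro x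
  have e : 2 * Real.pi * ((j / 2 : ℕ) : ℝ) * (x + 1)
      = 2 * Real.pi * ((j / 2 : ℕ) : ℝ) * x + ((j / 2 : ℕ) : ℝ) * (2 * Real.pi) := by ring
  simp only [trigBasis, e, Real.cos_add_nat_mul_two_pi, Real.sin_add_nat_mul_two_pi]

theorem thetaHat_sub (n : ℕ) (f g : Fin n → ℝ) (j : Fin n) :
    thetaHat n (fun l => f l - g l) j = thetaHat n f j - thetaHat n g j := by
  simp only [thetaHat, sub_mul, Finset.sum_sub_distrib]
  ring

theorem thetaHat_add (n : ℕ) (f g : Fin n → ℝ) (j : Fin n) :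
    thetaHat n (fun l => f l + g l) j = thetaHat n f j + thetaHat n g j := by
  simp only [thetaHat, add_mul, Finset.sum_add_distrib]
  ring

/-- Discrete Fourier coefficients beyond `d` are controlled by the discrete derivative. -/
theorem sum_tail_thetaHat_sq_le {n : ℕ} (hn : Odd n) {S : ℝ → ℝ} (hS : Function.Periodic S 1)
    (d : ℕ) :
    4 * (d : ℝ) ^ 2 / n ^ 2 * ∑ j ∈ Finset.univ.filter (fun j : Fin n => d + 1 ≤ (j : ℕ) + 1),
        thetaHat n (fun l => S (design n l)) j ^ 2
      ≤ (1 / (n : ℝ)) * ∑ l, (S (design n l - 1 / n) - S (design n l)) ^ 2 := by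
  have hn1 := hn.pos
  obtain ⟨m, hnm⟩ := id hn
  have hn0 : (0 : ℝ) < n := by exact_mod_cast hn1
  let T : ℕ → ℝ := fun j =>
    (1 / (n : ℝ)) * ∑ l : Fin n, S (design n l) * trigBasis (j + 1) (design n l)
  -- By periodicity the shift is moved from S onto the basis function.
  let T' : ℕ → ℝ := fun j =>
    (1 / (n : ℝ)) * ∑ l : Fin n, S (design n l) * trigBasis (j + 1) (design n l + 1 / n)
  have hT : ∀ j : Fin n, thetaHat n (fun l => S (design n l)) j = T j := fun j => rfl
  have hT' : ∀ j : Fin n, thetaHat n (fun l => S (design n l - 1 / n)) j = T' j := by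
    intro j
    have hper : Function.Periodic (fun x => S x * trigBasis ((j : ℕ) + 1) (x + 1 / n)) 1 := by
      intro x
      simp only
      rw [hS x, add_right_comm, trigBasis_periodic]
    have := sum_design_sub hn1 hper
    simp only [T', ← this, thetaHat, basisFn, sub_add_cancel]
  let w : ℕ → ℝ := fun k => 4 * Real.sin (Real.pi * ((k + 1 : ℕ) : ℝ) / n) ^ 2
  have hpair : ∀ k : ℕ, (T' (2 * k + 1) - T (2 * k + 1)) ^ 2 + (T' (2 * k + 2) - T (2 * k + 2)) ^ 2
      = w k * (T (2 * k + 1) ^ 2 + T (2 * k + 2) ^ 2) := by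
    intro k
    -- The shift rotates the cosine-sine pair of frequency k + 1 by the angle α; rotation minus
    -- identity scales squared length by 2 - 2 cos α = 4 sin²(α/2).
    set α : ℝ := 2 * (Real.pi * ((k + 1 : ℕ) : ℝ) / n) with hα
    have harg : ∀ x : ℝ, 2 * Real.pi * ((k + 1 : ℕ) : ℝ) * (x + 1 / n)
        = 2 * Real.pi * ((k + 1 : ℕ) : ℝ) * x + α := by
      intro x
      rw [hα]
      ring
    have e1 : T' (2 * k + 1) = Real.cos α * T (2 * k + 1) - Real.sin α * T (2 * k + 2) := by
      simp only [T, T', trigBasis_even, trigBasis_odd, harg, Real.cos_add, Finset.mul_sum,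
        ← Finset.sum_sub_distrib]
      exact Finset.sum_congr rfl fun l _ => by ring
    have e2 : T' (2 * k + 2) = Real.cos α * T (2 * k + 2) + Real.sin α * T (2 * k + 1) := by
      simp only [T, T', trigBasis_even, trigBasis_odd, harg, Real.sin_add, Finset.mul_sum,
        ← Finset.sum_add_distrib]
      exact Finset.sum_congr rfl fun l _ => by ring
    have hw : w k = 2 - 2 * Real.cos α := by
      simp only [w]
      rw [hα, Real.cos_two_mul, Real.sin_sq]
      ring
    rw [e1, e2, hw]
    linear_combination (T (2 * k + 1) ^ 2 + T (2 * k + 2) ^ 2) * Real.sin_sq_add_cos_sq α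
  -- Jordan's inequality sin x ≥ 2x/π applies because the frequency k + 1 ≤ m is below n/2.
  have hw : ∀ k : ℕ, k < m → 16 * ((k + 1 : ℕ) : ℝ) ^ 2 / n ^ 2 ≤ w k := by
    intro k hk
    have hx0 : 0 ≤ Real.pi * ((k + 1 : ℕ) : ℝ) / n := by positivity
    have hx1 : Real.pi * ((k + 1 : ℕ) : ℝ) / n ≤ Real.pi / 2 := by
      rw [div_le_div_iff₀ hn0 (by norm_num), mul_assoc]
      refine mul_le_mul_of_nonneg_left ?_ Real.pi_pos.le
      have : (k + 1) * 2 ≤ n := by omega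
      exact_mod_cast this
    have := Real.mul_le_sin hx0 hx1
    have e : 2 / Real.pi * (Real.pi * ((k + 1 : ℕ) : ℝ) / n) = 2 * ((k + 1 : ℕ) : ℝ) / n := by
      field_simp
    rw [e] at this
    have h2 : (2 * ((k + 1 : ℕ) : ℝ) / n) ^ 2 ≤ Real.sin (Real.pi * ((k + 1 : ℕ) : ℝ) / n) ^ 2 :=
      pow_le_pow_left₀ (by positivity) this 2
    simp only [w]
    calc 16 * ((k + 1 : ℕ) : ℝ) ^ 2 / n ^ 2 = 4 * (2 * ((k + 1 : ℕ) : ℝ) / n) ^ 2 := by ring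
      _ ≤ _ := by linarith
  rw [← sum_thetaHat_sq hn (fun l : Fin n => S (design n l - 1 / n) - S (design n l))]
  simp only [thetaHat_sub, hT, hT', Finset.sum_filter]
  rw [Fin.sum_univ_eq_sum_range (fun j => if d + 1 ≤ j + 1 then T j ^ 2 else 0),
    Fin.sum_univ_eq_sum_range (fun j => (T' j - T j) ^ 2), hnm, sum_range_two_mul_add_one,
    sum_range_two_mul_add_one, mul_add, ← hnm, Finset.mul_sum]
  refine add_le_add ?_ (Finset.sum_le_sum fun k hk => ?_)
  · rcases Nat.eq_zero_or_pos d with rfl | hd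
    · simpa using sq_nonneg _
    · rw [if_neg (by omega), mul_zero]
      positivity
  · rw [hpair]
    have hk' := Finset.mem_range.mp hk
    have hle := hw k hk'
    -- Block k occupies the zero-based indices 2k + 1 and 2k + 2, so it meets the tail only if d ≤
    -- 2(k + 1).
    have hd2 : d ≤ 2 * k + 2 →
        4 * (d : ℝ) ^ 2 / n ^ 2 ≤ 16 * ((k + 1 : ℕ) : ℝ) ^ 2 / n ^ 2 := by
      intro h
      have h1 : (d : ℝ) ≤ 2 * ((k + 1 : ℕ) : ℝ) := by
        have : d ≤ 2 * (k + 1) := by omega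
        exact_mod_cast this
      have h2 : (d : ℝ) ^ 2 ≤ (2 * ((k + 1 : ℕ) : ℝ)) ^ 2 :=
        pow_le_pow_left₀ (by positivity) h1 2
      refine div_le_div_of_nonneg_right ?_ (by positivity)
      nlinarith
    by_cases h : d ≤ 2 * k + 2
    · have h3 := (hd2 h).trans hle
      have h0 : 0 ≤ 4 * (d : ℝ) ^ 2 / n ^ 2 := by positivity
      refine mul_le_mul h3 (add_le_add ?_ ?_) (add_nonneg ?_ ?_) (h0.trans h3) <;>
      split_ifs <;> first | exact le_rfl | positivity
    · rw [if_neg (by omega), if_neg (by omega), add_zero, mul_zero]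
      simp only [w]
      positivity

/-- Cauchy–Schwarz against the constant 1, read off from the nonnegativity of the integral of (f -
c)², with c the mean of f. -/
theorem sq_integral_le {f : ℝ → ℝ} {a b : ℝ} (hab : a < b) (hf : IntervalIntegrable f volume a b)
    (hf2 : IntervalIntegrable (fun t => f t ^ 2) volume a b) :
    (∫ t in a..b, f t) ^ 2 ≤ (b - a) * ∫ t in a..b, f t ^ 2 := by
  set c := (∫ t in a..b, f t) / (b - a) with hc
  have h0 : 0 ≤ ∫ t in a..b, (f t - c) ^ 2 :=
    intervalIntegral.integral_nonneg hab.le fun t _ => sq_nonneg _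
  have e : ∫ t in a..b, (f t - c) ^ 2
      = (∫ t in a..b, f t ^ 2) - 2 * c * (∫ t in a..b, f t) + (b - a) * c ^ 2 := by
    have : ∀ t, (f t - c) ^ 2 = f t ^ 2 - 2 * c * f t + c ^ 2 := fun t => by ring
    simp only [this]
    rw [intervalIntegral.integral_add (hf2.sub (hf.const_mul _)) intervalIntegrable_const,
      intervalIntegral.integral_sub hf2 (hf.const_mul _), intervalIntegral.integral_const_mul,
      intervalIntegral.integral_const, smul_eq_mul]
  have hba : 0 < b - a := sub_pos.mpr hab
  have hcI : ∫ t in a..b, f t = (b - a) * c := by rw [hc]; field_simp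
  rw [e, hcI] at h0
  rw [hcI]
  nlinarith

/-- The fundamental theorem of calculus and Cauchy–Schwarz on each cell of length 1/n. -/
theorem sum_sq_increment_le {n : ℕ} (hn : 0 < n) {S : ℝ → ℝ} (hd : Differentiable ℝ S)
    (h2 : IntervalIntegrable (fun t => deriv S t ^ 2) volume 0 1) :
    ∑ l, (S (design n l - 1 / n) - S (design n l)) ^ 2
      ≤ (1 / (n : ℝ)) * ∫ t in (0 : ℝ)..1, deriv S t ^ 2 := by
  have hn0 : (0 : ℝ) < n := by exact_mod_cast hn
  -- From |S'| ≤ 1 + |S'|². Integrability of an everywhere existing derivative is enough for the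
  -- fundamental theorem; continuity of S' is not needed.
  have h1 : IntervalIntegrable (deriv S) volume 0 1 := by
    refine (intervalIntegrable_const (c := (1 : ℝ)).add h2).mono_fun
      (measurable_deriv S).aestronglyMeasurable (Eventually.of_forall fun t => ?_)
    simp only [Real.norm_eq_abs]
    rw [← sq_abs, abs_of_nonneg (a := 1 + |deriv S t| ^ 2) (by positivity)]
    nlinarith [sq_nonneg (|deriv S t| - 1), abs_nonneg (deriv S t)]
  let p : ℕ → ℝ := fun l => (l : ℝ) / n
  have hp : ∀ l < n, Set.uIcc (p l) (p (l + 1)) ⊆ Set.uIcc 0 1 := by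
    intro l hl
    have hl1 : ((l : ℝ) + 1) ≤ n := by exact_mod_cast hl
    refine Set.uIcc_subset_uIcc ?_ ?_ <;> rw [Set.mem_uIcc] <;> left <;> simp only [p]
    · exact ⟨by positivity, by rw [div_le_one hn0]; linarith⟩
    · push_cast
      exact ⟨by positivity, by rw [div_le_one hn0]; linarith⟩
  have hlen : ∀ l : ℕ, p (l + 1) - p l = 1 / n := by
    intro l
    simp only [p]
    push_cast
    ring
  have hsum : ∑ l ∈ Finset.range n, ∫ t in (p l)..(p (l + 1)), deriv S t ^ 2
      = ∫ t in (0 : ℝ)..1, deriv S t ^ 2 := by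
    rw [intervalIntegral.sum_integral_adjacent_intervals fun l hl => h2.mono_set (hp l hl)]
    simp only [p]
    rw [Nat.cast_zero, zero_div, div_self hn0.ne']
  have hterm : ∀ l < n, (S (p l) - S (p (l + 1))) ^ 2
      ≤ (1 / n) * ∫ t in (p l)..(p (l + 1)), deriv S t ^ 2 := by
    intro l hl
    have hlt : p l < p (l + 1) := by
      have : 0 < p (l + 1) - p l := by rw [hlen]; positivity
      linarith
    have hFTC := intervalIntegral.integral_eq_sub_of_hasDerivAt
      (fun t _ => (hd t).hasDerivAt) (h1.mono_set (hp l hl))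
    have := sq_integral_le hlt (h1.mono_set (hp l hl)) (h2.mono_set (hp l hl))
    rw [hFTC, hlen] at this
    rw [← neg_sq, neg_sub]
    exact this
  rw [← hsum, Finset.mul_sum, ← Fin.sum_univ_eq_sum_range
    (fun l => 1 / (n : ℝ) * ∫ t in (p l)..(p (l + 1)), deriv S t ^ 2)]
  refine Finset.sum_le_sum fun l _ => ?_
  have e1 : design n l - 1 / n = p l := by simp only [design, p]; ring
  have e2 : design n l = p ((l : ℕ) + 1) := by simp only [design, p]; push_cast; ring
  rw [e1, e2]
  exact hterm l l.2

theorem sum_tail_thetaHat_sq_le_of_mem_sobolevBall {n : ℕ} (hn : Odd n) {S : ℝ → ℝ} {r : ℝ}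
    (hS : S ∈ sobolevBall 1 r) {d : ℕ} (hd : 1 ≤ d) :
    ∑ j ∈ Finset.univ.filter (fun j : Fin n => d + 1 ≤ (j : ℕ) + 1),
        thetaHat n (fun l => S (design n l)) j ^ 2 ≤ r / (4 * (d : ℝ) ^ 2) := by
  obtain ⟨hper, hdiff, hint, hle⟩ := hS
  have hn0 : (0 : ℝ) < n := by exact_mod_cast hn.pos
  have hd0 : (0 : ℝ) < d := by exact_mod_cast hd
  have hD : Differentiable ℝ S := by simpa using hdiff 0 (by norm_num)
  have h2 := hint 1 le_rfl
  rw [Finset.sum_range_succ, Finset.sum_range_one] at hle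
  simp only [iteratedDeriv_one, iteratedDeriv_zero] at h2 hle
  have h0 : 0 ≤ ∫ t in (0 : ℝ)..1, S t ^ 2 :=
    intervalIntegral.integral_nonneg zero_le_one fun t _ => sq_nonneg _
  have h3 := sum_sq_increment_le hn.pos hD h2
  have h4 := sum_tail_thetaHat_sq_le hn hper d
  set X := ∑ j ∈ Finset.univ.filter (fun j : Fin n => d + 1 ≤ (j : ℕ) + 1),
        thetaHat n (fun l => S (design n l)) j ^ 2
  have h5 : 4 * (d : ℝ) ^ 2 / n ^ 2 * X ≤ (1 / (n : ℝ)) * ((1 / n) * r) := by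
    refine h4.trans (mul_le_mul_of_nonneg_left (h3.trans ?_) (by positivity))
    exact mul_le_mul_of_nonneg_left (by linarith) (by positivity)
  rw [le_div_iff₀ (by positivity)]
  have h6 := mul_le_mul_of_nonneg_left h5 (by positivity : (0 : ℝ) ≤ (n : ℝ) ^ 2)
  field_simp at h6
  linarith

/-! ### Second moments of linear and bilinear forms of the noise -/

section Moments

variable {Ω : Type*} [MeasurableSpace Ω] {μ : Measure Ω}

/-- The variance of |X| is nonnegative. -/
theorem integral_abs_le_sqrt [IsProbabilityMeasure μ] {X : Ω → ℝ} (hX : MemLp X 2 μ) {v : ℝ}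
    (hv : ∫ ω, X ω ^ 2 ∂μ ≤ v) : ∫ ω, |X ω| ∂μ ≤ √v := by
  refine Real.le_sqrt_of_sq_le (le_trans ?_ hv)
  have h1 : Integrable (fun ω => |X ω|) μ := (hX.integrable (by norm_num)).abs
  have h2 : Integrable (fun ω => X ω ^ 2) μ := hX.integrable_sq
  set m := ∫ ω, |X ω| ∂μ with hm
  have h0 : 0 ≤ ∫ ω, (|X ω| - m) ^ 2 ∂μ := integral_nonneg fun ω => sq_nonneg _
  have e : ∀ ω, (|X ω| - m) ^ 2 = X ω ^ 2 - 2 * m * |X ω| + m ^ 2 := by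
    intro ω
    rw [← sq_abs (X ω)]
    ring
  simp only [e] at h0
  have h3 : Integrable (fun ω => X ω ^ 2 - 2 * m * |X ω|) μ := h2.sub (h1.const_mul _)
  rw [integral_add h3 (integrable_const _),
    integral_sub h2 (h1.const_mul _), integral_const_mul, ← hm, integral_const] at h0
  simp only [probReal_univ, one_smul] at h0
  nlinarith

theorem integral_sum_sq_of_orthogonal {ι : Type*} (s : Finset ι) {X : ι → Ω → ℝ}
    (hX : ∀ i ∈ s, MemLp (X i) 2 μ) (ho : ∀ i ∈ s, ∀ j ∈ s, i ≠ j → ∫ ω, X i ω * X j ω ∂μ = 0)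
    {v : ℝ} (hv : ∀ i ∈ s, ∫ ω, X i ω ^ 2 ∂μ = v) (a : ι → ℝ) :
    ∫ ω, (∑ i ∈ s, a i * X i ω) ^ 2 ∂μ = v * ∑ i ∈ s, a i ^ 2 := by
  classical
  have e : ∀ ω, (∑ i ∈ s, a i * X i ω) ^ 2
      = ∑ i ∈ s, ∑ j ∈ s, (a i * a j) * (X i ω * X j ω) := by
    intro ω
    rw [sq, Finset.sum_mul_sum]
    exact Finset.sum_congr rfl fun i _ => Finset.sum_congr rfl fun j _ => by ring
  have hint : ∀ i ∈ s, ∀ j ∈ s, Integrable (fun ω => (a i * a j) * (X i ω * X j ω)) μ :=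
    fun i hi j hj => ((hX i hi).integrable_mul (hX j hj)).const_mul _
  simp only [e]
  rw [integral_finsetSum _ fun i hi => integrable_finsetSum _ fun j hj => hint i hi j hj,
    Finset.mul_sum]
  refine Finset.sum_congr rfl fun i hi => ?_
  rw [integral_finsetSum _ fun j hj => hint i hi j hj, Finset.sum_eq_single i]
  · rw [integral_const_mul]
    simp only [← sq]
    rw [hv i hi]
    ring
  · intro j hj hji
    rw [integral_const_mul, ho i hi j hj hji.symm, mul_zero]
  · exact fun h => absurd hi h

theorem memLp_sum_mul {ι : Type*} (s : Finset ι) {X : ι → Ω → ℝ}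
    (hX : ∀ i ∈ s, MemLp (X i) 2 μ) (a : ι → ℝ) :
    MemLp (fun ω => ∑ i ∈ s, a i * X i ω) 2 μ :=
  memLp_finsetSum _ fun i hi => (hX i hi).const_mul (a i)

namespace NoiseModel

variable {n : ℕ} {σ ξ : Fin n → Ω → ℝ} {σs ξs : ℝ}

/-- Source of all the orthogonality relations between noise monomials: a variable that occurs once,
to the first power, is independent of the remaining factors and has mean zero. The product rule for
independent factors asks only for measurability, so the integrability of `f` plays no role. -/
theorem integral_mul_eq_zero (h : NoiseModel μ n σ ξ σs ξs) {k : Fin n} {s : Finset (Fin n)}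
    (hk : k ∉ s) {f : (s → ℝ) → ℝ} (hf : Measurable f) :
    ∫ ω, ξ k ω * f (fun i => ξ i ω) ∂μ = 0 := by
  have hi := h.indep_xi.indepFun_finset {k} s (Finset.disjoint_singleton_left.mpr hk)
    h.measurable_xi
  have hi' : IndepFun (ξ k) (fun ω => f (fun i => ξ i ω)) μ :=
    hi.comp (φ := fun v : ({k} : Finset (Fin n)) → ℝ => v ⟨k, Finset.mem_singleton_self k⟩)
      (measurable_pi_apply _) hf
  have := hi'.integral_fun_mul_eq_mul_integral (h.measurable_xi k).aestronglyMeasurable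
    (hf.comp (measurable_pi_lambda _ fun i => h.measurable_xi i)).aestronglyMeasurable
  rw [this, h.mean_xi, zero_mul]

theorem integral_xi_mul_xi (h : NoiseModel μ n σ ξ σs ξs) {k l : Fin n} (hkl : k ≠ l) :
    ∫ ω, ξ k ω * ξ l ω ∂μ = 0 :=
  h.integral_mul_eq_zero (s := {l}) (by simpa using hkl)
    (f := fun v => v ⟨l, Finset.mem_singleton_self l⟩) (measurable_pi_apply _)

theorem integral_xi_mul_three (h : NoiseModel μ n σ ξ σs ξs) {k a b c : Fin n} (ha : k ≠ a)
    (hb : k ≠ b) (hc : k ≠ c) : ∫ ω, ξ k ω * (ξ a ω * (ξ b ω * ξ c ω)) ∂μ = 0 := by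
  refine h.integral_mul_eq_zero (s := {a, b, c}) (by simp [ha, hb, hc])
    (f := fun v => v ⟨a, by simp⟩ * (v ⟨b, by simp⟩ * v ⟨c, by simp⟩)) ?_
  fun_prop

theorem indepFun_sq (h : NoiseModel μ n σ ξ σs ξs) {k l : Fin n} (hkl : k ≠ l) :
    IndepFun (fun ω => ξ k ω ^ 2) (fun ω => ξ l ω ^ 2) μ :=
  (h.indep_xi.indepFun hkl).comp (φ := fun x => x ^ 2) (ψ := fun x => x ^ 2)
    (by fun_prop) (by fun_prop)

theorem integrable_pow_four (h : NoiseModel μ n σ ξ σs ξs) (l : Fin n) :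
    Integrable (fun ω => ξ l ω ^ 4) μ := by
  have := (h.memLp_xi l).integrable_norm_pow (by norm_num)
  refine this.congr (Eventually.of_forall fun ω => ?_)
  simp only [Real.norm_eq_abs]
  exact (show Even 4 by decide).pow_abs _

variable [IsProbabilityMeasure μ]

theorem memLp_two (h : NoiseModel μ n σ ξ σs ξs) (l : Fin n) : MemLp (ξ l) 2 μ :=
  (h.memLp_xi l).mono_exponent (by norm_num)

theorem integrable_sq (h : NoiseModel μ n σ ξ σs ξs) (l : Fin n) :
    Integrable (fun ω => ξ l ω ^ 2) μ := (h.memLp_two l).integrable_sq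

/-- The squares are independent and integrable, so no moment beyond the second is spent on
off-diagonal products. -/
theorem memLp_mul (h : NoiseModel μ n σ ξ σs ξs) {k l : Fin n} (hkl : k ≠ l) :
    MemLp (fun ω => ξ k ω * ξ l ω) 2 μ := by
  have hm : Measurable fun ω => ξ k ω * ξ l ω := (h.measurable_xi k).mul (h.measurable_xi l)
  rw [memLp_two_iff_integrable_sq hm.aestronglyMeasurable]
  simp only [mul_pow]
  exact (h.indepFun_sq hkl).integrable_mul (h.integrable_sq k) (h.integrable_sq l)

theorem integral_mul_sq (h : NoiseModel μ n σ ξ σs ξs) {k l : Fin n} (hkl : k ≠ l) :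
    ∫ ω, (ξ k ω * ξ l ω) ^ 2 ∂μ = 1 := by
  simp only [mul_pow]
  rw [(h.indepFun_sq hkl).integral_fun_mul_eq_mul_integral
    (h.integrable_sq k).aestronglyMeasurable (h.integrable_sq l).aestronglyMeasurable,
    h.second_moment_xi, h.second_moment_xi, one_mul]

theorem memLp_sq_sub_one (h : NoiseModel μ n σ ξ σs ξs) (l : Fin n) :
    MemLp (fun ω => ξ l ω ^ 2 - 1) 2 μ := by
  have hm : Measurable fun ω => ξ l ω ^ 2 := (h.measurable_xi l).pow_const 2
  refine MemLp.sub ?_ (memLp_const 1)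
  rw [memLp_two_iff_integrable_sq hm.aestronglyMeasurable]
  have := (h.memLp_xi l).integrable_norm_pow (by norm_num)
  refine this.congr (Eventually.of_forall fun ω => ?_)
  simp only [Real.norm_eq_abs, ← pow_mul]
  norm_num
  exact (show Even 4 by decide).pow_abs _

theorem integral_sq_sub_one_sq (h : NoiseModel μ n σ ξ σs ξs) (l : Fin n) :
    ∫ ω, (ξ l ω ^ 2 - 1) ^ 2 ∂μ = ξs - 1 := by
  have e : ∀ ω, (ξ l ω ^ 2 - 1) ^ 2 = ξ l ω ^ 4 - 2 * ξ l ω ^ 2 + 1 := fun ω => by ring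
  simp only [e]
  have h3 : Integrable (fun ω => ξ l ω ^ 4 - 2 * ξ l ω ^ 2) μ :=
    (h.integrable_pow_four l).sub ((h.integrable_sq l).const_mul 2)
  rw [integral_add h3 (integrable_const _),
    integral_sub (h.integrable_pow_four l) ((h.integrable_sq l).const_mul 2),
    integral_const_mul, h.fourth_moment_xi, h.second_moment_xi]
  simp
  ring

theorem integral_sq_sub_one_mul (h : NoiseModel μ n σ ξ σs ξs) {k l : Fin n} (hkl : k ≠ l) :
    ∫ ω, (ξ k ω ^ 2 - 1) * (ξ l ω ^ 2 - 1) ∂μ = 0 := by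
  have hi : IndepFun (fun ω => ξ k ω ^ 2 - 1) (fun ω => ξ l ω ^ 2 - 1) μ :=
    (h.indep_xi.indepFun hkl).comp (φ := fun x => x ^ 2 - 1) (ψ := fun x => x ^ 2 - 1)
      (by fun_prop) (by fun_prop)
  rw [hi.integral_fun_mul_eq_mul_integral (h.memLp_sq_sub_one k).aestronglyMeasurable
    (h.memLp_sq_sub_one l).aestronglyMeasurable, integral_sub (h.integrable_sq k)
    (integrable_const _), h.second_moment_xi]
  simp

theorem integral_linear_sq (h : NoiseModel μ n σ ξ σs ξs) (a : Fin n → ℝ) :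
    ∫ ω, (∑ l, a l * ξ l ω) ^ 2 ∂μ = ∑ l, a l ^ 2 := by
  rw [integral_sum_sq_of_orthogonal _ (fun i _ => h.memLp_two i)
    (fun i _ j _ hij => h.integral_xi_mul_xi hij) (fun i _ => h.second_moment_xi i), one_mul]

theorem memLp_linear (h : NoiseModel μ n σ ξ σs ξs) (a : Fin n → ℝ) :
    MemLp (fun ω => ∑ l, a l * ξ l ω) 2 μ := memLp_sum_mul _ (fun i _ => h.memLp_two i) a

theorem integral_linear (h : NoiseModel μ n σ ξ σs ξs) (a : Fin n → ℝ) :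
    ∫ ω, ∑ l, a l * ξ l ω ∂μ = 0 := by
  rw [integral_finsetSum _ fun i _ => ((h.memLp_two i).integrable (by norm_num)).const_mul _]
  simp [integral_const_mul, h.mean_xi]

theorem memLp_diagonal (h : NoiseModel μ n σ ξ σs ξs) (a : Fin n → ℝ) :
    MemLp (fun ω => ∑ l, a l * (ξ l ω ^ 2 - 1)) 2 μ :=
  memLp_sum_mul _ (fun i _ => h.memLp_sq_sub_one i) a

theorem integral_diagonal_sq_le (h : NoiseModel μ n σ ξ σs ξs) (a : Fin n → ℝ) :
    ∫ ω, (∑ l, a l * (ξ l ω ^ 2 - 1)) ^ 2 ∂μ ≤ ξs * ∑ l, a l ^ 2 := by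
  rw [integral_sum_sq_of_orthogonal _ (fun i _ => h.memLp_sq_sub_one i)
    (fun i _ j _ hij => h.integral_sq_sub_one_mul hij) (fun i _ => h.integral_sq_sub_one_sq i)]
  have : 0 ≤ ∑ l, a l ^ 2 := Finset.sum_nonneg fun l _ => sq_nonneg _
  nlinarith

end NoiseModel

end Moments

/-- The pairs `(k, l)` with `k < l`. -/
def orderedPairs (n : ℕ) : Finset (Fin n × Fin n) :=
  Finset.univ.filter fun p => p.1 < p.2

theorem sum_sum_eq_diag_add {n : ℕ} (f : Fin n → Fin n → ℝ) (hf : ∀ k l, f k l = f l k) :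
    ∑ k, ∑ l, f k l = ∑ l, f l l + 2 * ∑ p ∈ orderedPairs n, f p.1 p.2 := by
  have h1 : ∑ p ∈ orderedPairs n, f p.1 p.2 = ∑ k, ∑ l, if k < l then f k l else 0 := by
    rw [orderedPairs, Finset.sum_filter, Fintype.sum_prod_type]
  have h2 : ∑ k, ∑ l, (if k < l then f k l else 0) = ∑ k, ∑ l, if l < k then f k l else 0 := by
    rw [Finset.sum_comm]
    exact Finset.sum_congr rfl fun k _ => Finset.sum_congr rfl fun l _ => by rw [hf]
  have h3 : ∑ l, f l l = ∑ k, ∑ l, if k = l then f k l else 0 := by simp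
  rw [two_mul, h1]
  nth_rewrite 2 [h2]
  rw [h3]
  simp only [← Finset.sum_add_distrib]
  refine Finset.sum_congr rfl fun k _ => Finset.sum_congr rfl fun l _ => ?_
  rcases lt_trichotomy k l with h | h | h
  · simp [h, h.ne, h.not_gt]
  · simp [h]
  · simp [h, h.ne', h.not_gt]

namespace NoiseModel

variable {Ω : Type*} [MeasurableSpace Ω] {μ : Measure Ω} {n : ℕ}
  {σ ξ : Fin n → Ω → ℝ} {σs ξs : ℝ}

/-- Two distinct increasing pairs always leave an index of p that does not occur in q. If p.1 = q.1,
then p.2 ≠ q.2; if p.1 = q.2, then p.2 exceeds both entries of q. In either case p.2 occurs only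
once. -/
theorem integral_pair_mul_pair (h : NoiseModel μ n σ ξ σs ξs) {p q : Fin n × Fin n}
    (hp : p.1 < p.2) (hq : q.1 < q.2) (hpq : p ≠ q) :
    ∫ ω, ξ p.1 ω * ξ p.2 ω * (ξ q.1 ω * ξ q.2 ω) ∂μ = 0 := by
  by_cases h1 : p.1 ≠ q.1 ∧ p.1 ≠ q.2
  · rw [← h.integral_xi_mul_three hp.ne h1.1 h1.2]
    exact integral_congr_ae (Eventually.of_forall fun ω => by ring)
  · have h2 : p.2 ≠ q.1 ∧ p.2 ≠ q.2 := by
      rw [not_and_or, not_not, not_not] at h1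
      rcases h1 with h1 | h1
      · refine ⟨fun h3 => ?_, fun h3 => hpq (Prod.ext h1 h3)⟩
        exact hp.ne (h1.trans h3.symm)
      · constructor <;> intro h3 <;> omega
    rw [← h.integral_xi_mul_three hp.ne' h2.1 h2.2]
    exact integral_congr_ae (Eventually.of_forall fun ω => by ring)

variable [IsProbabilityMeasure μ]

theorem memLp_bilinear (h : NoiseModel μ n σ ξ σs ξs) (a : Fin n × Fin n → ℝ) :
    MemLp (fun ω => ∑ p ∈ orderedPairs n, a p * (ξ p.1 ω * ξ p.2 ω)) 2 μ :=
  memLp_sum_mul _ (fun _ hp => h.memLp_mul (Finset.mem_filter.mp hp).2.ne) a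

theorem integral_bilinear_sq (h : NoiseModel μ n σ ξ σs ξs) (a : Fin n × Fin n → ℝ) :
    ∫ ω, (∑ p ∈ orderedPairs n, a p * (ξ p.1 ω * ξ p.2 ω)) ^ 2 ∂μ
      = ∑ p ∈ orderedPairs n, a p ^ 2 := by
  rw [integral_sum_sq_of_orthogonal (orderedPairs n) (X := fun p ω => ξ p.1 ω * ξ p.2 ω)
    (fun _ hp => h.memLp_mul (Finset.mem_filter.mp hp).2.ne)
    (fun _ hp _ hq hpq => h.integral_pair_mul_pair (Finset.mem_filter.mp hp).2
      (Finset.mem_filter.mp hq).2 hpq)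
    (fun _ hp => h.integral_mul_sq (Finset.mem_filter.mp hp).2.ne), one_mul]

end NoiseModel

/-! ### The pathwise comparison with a fixed weight vector -/

/-- The kernel `∑_j c(j) φ_j(x_k) φ_j(x_l)`. -/
def kernel (n : ℕ) (c : Fin n → ℝ) (k l : Fin n) : ℝ :=
  ∑ j, c j * basisFn n j (design n k) * basisFn n j (design n l)

/-- The linear noise term `∑_j c(j) θ_j(a) θ_j(η)`. -/
def crossTerm (n : ℕ) (a η c : Fin n → ℝ) : ℝ := ∑ j, c j * thetaHat n a j * thetaHat n η j

/-- The off-diagonal part of `∑_j c(j) θ_j(s x)²`. -/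
def bilinTerm (n : ℕ) (c s x : Fin n → ℝ) : ℝ :=
  ∑ p ∈ orderedPairs n,
    (1 / (n : ℝ) ^ 2 * (2 * (s p.1 * s p.2 * kernel n c p.1 p.2))) * (x p.1 * x p.2)

/-- The centred diagonal noise term `n⁻² ∑_l s_l² w_l (x_l² - 1)`. -/
def diagTerm (n : ℕ) (w s x : Fin n → ℝ) : ℝ :=
  ∑ l, (1 / (n : ℝ) ^ 2 * (s l ^ 2 * w l)) * (x l ^ 2 - 1)

/-- `∑_j λ(j)^i (φ_j(x_l)² - 1)`. -/
def basisDev (i n : ℕ) (lam : Fin n → ℝ) (l : Fin n) : ℝ :=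
  ∑ j, lam j ^ i * (basisFn n j (design n l) ^ 2 - 1)

/-- The mean noise variance `n⁻¹ ∑_l s_l²`. -/
def meanVar (n : ℕ) (s : Fin n → ℝ) : ℝ := (1 / (n : ℝ)) * ∑ l, s l ^ 2

/-- The penalty with the true mean noise variance. -/
def truePenalty (n : ℕ) (s lam : Fin n → ℝ) : ℝ := (∑ j, lam j ^ 2) * meanVar n s / n

theorem kernel_comm (n : ℕ) (c : Fin n → ℝ) (k l : Fin n) : kernel n c k l = kernel n c l k :=
  Finset.sum_congr rfl fun j _ => by ring

theorem kernel_diag (n : ℕ) (c : Fin n → ℝ) (l : Fin n) :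
    kernel n c l l = ∑ j, c j + basisDev 1 n c l := by
  rw [kernel, basisDev, ← Finset.sum_add_distrib]
  exact Finset.sum_congr rfl fun j _ => by ring

theorem meanVar_nonneg (n : ℕ) (s : Fin n → ℝ) : 0 ≤ meanVar n s :=
  mul_nonneg (by positivity) (Finset.sum_nonneg fun l _ => sq_nonneg _)

theorem truePenalty_nonneg (n : ℕ) (s lam : Fin n → ℝ) : 0 ≤ truePenalty n s lam :=
  div_nonneg (mul_nonneg (Finset.sum_nonneg fun _ _ => sq_nonneg _) (meanVar_nonneg n s))
    (Nat.cast_nonneg n)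

theorem sum_mul_thetaHat_sq_eq_kernel (n : ℕ) (c η : Fin n → ℝ) :
    ∑ j, c j * thetaHat n η j ^ 2
      = 1 / (n : ℝ) ^ 2 * ∑ k, ∑ l, η k * η l * kernel n c k l := by
  have h : ∀ j, c j * thetaHat n η j ^ 2 = 1 / (n : ℝ) ^ 2 * ∑ k, ∑ l, η k * η l *
      (c j * basisFn n j (design n k) * basisFn n j (design n l)) := by
    intro j
    have : c j * thetaHat n η j ^ 2 = 1 / (n : ℝ) ^ 2 * (c j *
        ((∑ k, η k * basisFn n j (design n k)) * ∑ l, η l * basisFn n j (design n l))) := by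
      rw [thetaHat]
      ring
    rw [this, Finset.sum_mul_sum]
    simp only [Finset.mul_sum]
    exact Finset.sum_congr rfl fun k _ => Finset.sum_congr rfl fun l _ => by ring
  rw [Finset.sum_congr rfl fun j _ => h j, ← Finset.mul_sum, Finset.sum_comm]
  congr 1
  refine Finset.sum_congr rfl fun k _ => ?_
  rw [Finset.sum_comm]
  refine Finset.sum_congr rfl fun l _ => ?_
  rw [kernel, Finset.mul_sum]

/-- When x is the noise, the first two terms are centred and the last is the mean, because x_l² has
mean 1. -/
theorem sum_mul_thetaHat_sq_eq (n : ℕ) (c s x : Fin n → ℝ) :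
    ∑ j, c j * thetaHat n (fun l => s l * x l) j ^ 2
      = bilinTerm n c s x + diagTerm n (fun l => kernel n c l l) s x
        + 1 / (n : ℝ) ^ 2 * ∑ l, s l ^ 2 * kernel n c l l := by
  rw [sum_mul_thetaHat_sq_eq_kernel, sum_sum_eq_diag_add _ fun k l => by
    rw [kernel_comm n c k l]; ring]
  simp only [bilinTerm, diagTerm, mul_add, Finset.mul_sum]
  rw [add_comm, add_assoc, ← Finset.sum_add_distrib]
  congr 1
  · exact Finset.sum_congr rfl fun p _ => by ring
  · exact Finset.sum_congr rfl fun p _ => by ring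

theorem diagTerm_const_add (n : ℕ) (t : ℝ) (w s x : Fin n → ℝ) :
    diagTerm n (fun l => t + w l) s x = t * diagTerm n (fun _ => 1) s x + diagTerm n w s x := by
  simp only [diagTerm, Finset.mul_sum, ← Finset.sum_add_distrib]
  exact Finset.sum_congr rfl fun l _ => by ring

theorem loss_eq_sum {n : ℕ} (hn : Odd n) (S : ℝ → ℝ) (y lam : Fin n → ℝ) :
    loss n S y lam
      = ∑ j, (lam j * thetaHat n y j - thetaHat n (fun l => S (design n l)) j) ^ 2 := by
  have hn0 : (n : ℝ) ≠ 0 := by exact_mod_cast hn.pos.ne'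
  have h : ∀ l, wlsEst n y lam (design n l) - S (design n l)
      = ∑ j, (lam j * thetaHat n y j - thetaHat n (fun l => S (design n l)) j)
        * basisFn n j (design n l) := by
    intro l
    rw [← sum_thetaHat_mul_basisFn hn (fun l => S (design n l)) l]
    simp only [wlsEst, sub_mul, Finset.sum_sub_distrib]
  simp only [loss, empNormSq, h]
  rw [sum_combination_sq hn]
  field_simp

/-- With y_j = θ_j + η_j, the cross product in the loss differs from the one in the cost by y_j² -
y_j θ_j = θ_j η_j + η_j². The quadratic part is then decomposed, and φ_j² = 1 + (φ_j² - 1) on the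
diagonal of the kernel isolates the mean noise variance that the correction ς̂_n/n is meant to
cancel. -/
theorem loss_eq_cost_add {n : ℕ} (hn : Odd n) (d : ℕ) (ρ : ℝ) (S : ℝ → ℝ) (s x lam : Fin n → ℝ)
    {y : Fin n → ℝ} (hy : y = fun l => S (design n l) + s l * x l) :
    loss n S y lam = cost n d ρ y lam + ∑ j, thetaHat n (fun l => S (design n l)) j ^ 2
      - ρ * penalty n d y lam
      + 2 * (crossTerm n (fun l => S (design n l)) (fun l => s l * x l) lam + bilinTerm n lam s x
        + (∑ j, lam j) * diagTerm n (fun _ => 1) s x + diagTerm n (basisDev 1 n lam) s x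
        + 1 / (n : ℝ) ^ 2 * ∑ l, s l ^ 2 * basisDev 1 n lam l
        + (∑ j, lam j) * (meanVar n s - varEst n d y) / n) := by
  have hq := sum_mul_thetaHat_sq_eq n lam s x
  simp only [kernel_diag] at hq
  rw [diagTerm_const_add] at hq
  simp only [mul_add, Finset.sum_add_distrib] at hq
  have hq' : ∑ j, lam j * thetaHat n (fun l => s l * x l) j ^ 2 - (∑ j, lam j) * varEst n d y / n
      = bilinTerm n lam s x + (∑ j, lam j) * diagTerm n (fun _ => 1) s x
        + diagTerm n (basisDev 1 n lam) s x
        + 1 / (n : ℝ) ^ 2 * ∑ l, s l ^ 2 * basisDev 1 n lam l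
        + (∑ j, lam j) * (meanVar n s - varEst n d y) / n := by
    rw [hq, ← Finset.sum_mul, meanVar]
    ring
  have hy' : ∀ j, thetaHat n y j
      = thetaHat n (fun l => S (design n l)) j + thetaHat n (fun l => s l * x l) j := by
    intro j
    rw [hy, ← thetaHat_add]
  rw [loss_eq_sum hn]
  have e : ∀ A B C D E F : ℝ, A + B + C + D + E + F = A + (B + C + D + E + F) := by
    intros; ring
  rw [e, ← hq']
  simp only [cost, thetaTilde, crossTerm, hy']
  have e2 : (∑ j, lam j) * varEst n d y / n = ∑ j, lam j * ((1 / (n : ℝ)) * varEst n d y) := by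
    rw [← Finset.sum_mul]
    ring
  have e3 : ∀ A B C D E : ℝ, A - B + C + D - C + E = A - B + D + E := by
    intros; ring
  rw [e2, e3, ← Finset.sum_sub_distrib, ← Finset.sum_add_distrib, Finset.mul_sum,
    Finset.mul_sum, ← Finset.sum_sub_distrib, ← Finset.sum_add_distrib, ← Finset.sum_add_distrib]
  exact Finset.sum_congr rfl fun j _ => by ring

/-- The condition at P = 0 is essential: there the quotient is 0 by convention, so Q must vanish as
well. -/
theorem two_mul_le_add_sq_div {Q P ρ : ℝ} (hρ : 0 < ρ) (hP : 0 ≤ P) (h0 : P = 0 → Q = 0) :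
    2 * |Q| ≤ ρ * P + Q ^ 2 / (ρ * P) := by
  rcases hP.eq_or_lt with h | h
  · rw [h0 h.symm, ← h]
    simp
  · have h1 : 0 < ρ * P := mul_pos hρ h
    rw [← sq_abs Q, ← sub_nonneg]
    have : ρ * P + |Q| ^ 2 / (ρ * P) - 2 * |Q| = (ρ * P - |Q|) ^ 2 / (ρ * P) := by
      field_simp
      ring
    rw [this]
    positivity

theorem crossTerm_sub (n : ℕ) (a η c c' : Fin n → ℝ) :
    crossTerm n a η (fun j => c j - c' j) = crossTerm n a η c - crossTerm n a η c' := by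
  simp only [crossTerm, ← Finset.sum_sub_distrib]
  exact Finset.sum_congr rfl fun j _ => by ring

/-- `∑_j c(j)² θ_j²`. -/
def signalNormSq (n : ℕ) (a c : Fin n → ℝ) : ℝ := ∑ j, c j ^ 2 * thetaHat n a j ^ 2

theorem signalNormSq_nonneg (n : ℕ) (a c : Fin n → ℝ) : 0 ≤ signalNormSq n a c :=
  Finset.sum_nonneg fun j _ => by positivity

theorem eq_zero_of_signalNormSq_eq_zero {n : ℕ} {a c : Fin n → ℝ} (h : signalNormSq n a c = 0)
    (j : Fin n) : c j * thetaHat n a j = 0 := by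
  have := (Finset.sum_eq_zero_iff_of_nonneg fun j _ => by positivity).mp h j (Finset.mem_univ j)
  rw [← mul_pow] at this
  exact pow_eq_zero_iff two_ne_zero |>.mp this

/-- The contribution of the linear noise terms along `c`. -/
def crossRemainder (n : ℕ) (ρ : ℝ) (a η c : Fin n → ℝ) : ℝ :=
  crossTerm n a η (fun j => c j ^ 2) ^ 2 / signalNormSq n a c
    + crossTerm n a η c ^ 2 / (ρ * signalNormSq n a c)

theorem crossRemainder_nonneg {n : ℕ} {ρ : ℝ} (hρ : 0 < ρ) (a η c : Fin n → ℝ) :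
    0 ≤ crossRemainder n ρ a η c :=
  add_nonneg (div_nonneg (sq_nonneg _) (signalNormSq_nonneg _ _ _))
    (div_nonneg (sq_nonneg _) (mul_nonneg hρ.le (signalNormSq_nonneg _ _ _)))

/-- Let A = Σ c_j² θ_j². The splitting 2|M| ≤ ρA + M²/(ρA) involves the unobservable A, whereas the
losses control Σ c_j² y_j². A second splitting, applied to the cross term M1 of Σ c_j² (θ_j + η_j)²,
gives (1 - ρ)A ≤ Σ c_j² y_j² + M1²/(ρA). Multiplication by ρ cancels the ρ under M1², hence the
asymmetry of the two quotients in `crossRemainder`. -/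
theorem crossTerm_le {n : ℕ} {ρ : ℝ} (hρ : 0 < ρ) (hρ1 : ρ < 1) (a η c : Fin n → ℝ)
    {y : Fin n → ℝ} (hy : ∀ j, thetaHat n y j = thetaHat n a j + thetaHat n η j) :
    (1 - ρ) * (2 * crossTerm n a η c)
      ≤ ρ * ∑ j, c j ^ 2 * thetaHat n y j ^ 2 + crossRemainder n ρ a η c := by
  set A := signalNormSq n a c with hA
  set M := crossTerm n a η c with hM
  set M1 := crossTerm n a η (fun j => c j ^ 2) with hM1
  have hA0 : 0 ≤ A := signalNormSq_nonneg _ _ _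
  have hz : A = 0 → M = 0 := by
    intro h
    refine Finset.sum_eq_zero fun j _ => ?_
    rw [eq_zero_of_signalNormSq_eq_zero h j, zero_mul]
  have hz1 : A = 0 → M1 = 0 := by
    intro h
    refine Finset.sum_eq_zero fun j _ => ?_
    simp only
    rw [sq, mul_assoc (c j), eq_zero_of_signalNormSq_eq_zero h j, mul_zero, zero_mul]
  have h1 := two_mul_le_add_sq_div hρ hA0 hz
  have h2 := two_mul_le_add_sq_div hρ hA0 hz1
  have h3 : A + 2 * M1 ≤ ∑ j, c j ^ 2 * thetaHat n y j ^ 2 := by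
    rw [hA, hM1, signalNormSq, crossTerm, Finset.mul_sum, ← Finset.sum_add_distrib]
    refine Finset.sum_le_sum fun j _ => ?_
    rw [hy]
    nlinarith [sq_nonneg (c j * thetaHat n η j)]
  have h4 : (1 - ρ) * A ≤ ∑ j, c j ^ 2 * thetaHat n y j ^ 2 + M1 ^ 2 / (ρ * A) := by
    linarith [neg_abs_le M1]
  have h5 : 0 ≤ M ^ 2 / (ρ * A) := by positivity
  have h6 : ρ * (M1 ^ 2 / (ρ * A)) = M1 ^ 2 / A := by
    rw [← mul_div_assoc, mul_div_mul_left _ _ hρ.ne']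
  have h7 := mul_le_mul_of_nonneg_left h4 hρ.le
  rw [mul_add, h6] at h7
  have h8 : (1 - ρ) * (2 * M) ≤ (1 - ρ) * (ρ * A + M ^ 2 / (ρ * A)) :=
    mul_le_mul_of_nonneg_left (by linarith [le_abs_self M]) (by linarith)
  rw [crossRemainder, ← hA, ← hM, ← hM1]
  nlinarith

theorem abs_sum_sq_mul_le {n : ℕ} {s w : Fin n → ℝ} {σs u : ℝ} (hn : 0 < n)
    (hs : ∀ l, s l ^ 2 ≤ σs) (hw : ∀ l, |w l| ≤ u) :
    |1 / (n : ℝ) ^ 2 * ∑ l, s l ^ 2 * w l| ≤ u * σs / n := by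
  have hn0 : (0 : ℝ) < n := by exact_mod_cast hn
  rw [abs_mul, abs_of_nonneg (by positivity : (0 : ℝ) ≤ 1 / (n : ℝ) ^ 2)]
  have : |∑ l, s l ^ 2 * w l| ≤ ∑ _l : Fin n, σs * u := by
    refine (Finset.abs_sum_le_sum_abs _ _).trans (Finset.sum_le_sum fun l _ => ?_)
    rw [abs_mul, abs_of_nonneg (sq_nonneg _)]
    exact mul_le_mul (hs l) (hw l) (abs_nonneg _) ((sq_nonneg _).trans (hs l))
  rw [Finset.sum_const, Finset.card_univ, Fintype.card_fin, nsmul_eq_mul] at this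
  calc 1 / (n : ℝ) ^ 2 * |∑ l, s l ^ 2 * w l| ≤ 1 / (n : ℝ) ^ 2 * (n * (σs * u)) := by gcongr
    _ = u * σs / n := by field_simp

/-- The random remainder of the pathwise oracle inequality. -/
def pathRemainder (n d : ℕ) (Λ : Finset (Fin n → ℝ)) (ρ σs u v : ℝ) (S : ℝ → ℝ)
    (lam₀ s x : Fin n → ℝ) : ℝ :=
  ∑ lam ∈ Λ, crossRemainder n ρ (fun l => S (design n l)) (fun l => s l * x l)
      (fun j => lam j - lam₀ j)
    + (1 - ρ) * (4 * (u * σs / n) + 2 * v * |diagTerm n (fun _ => 1) s x|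
      + 4 * ∑ lam ∈ Λ, |diagTerm n (basisDev 1 n lam) s x|
      + 2 * ∑ lam ∈ Λ, bilinTerm n lam s x ^ 2 / (ρ * truePenalty n s lam)
      + (2 + 2 * ρ) * (v / n)
        * |meanVar n s - varEst n d (fun l => S (design n l) + s l * x l)|)

/-- After multiplication by 1 - ρ, the linear term costs ρ Σ (λ₁ - λ₀)² y_j², at most 2ρ times the
sum of the two losses. Moving that share of the loss of λ₁ to the left leaves 1 - 3ρ there and 1 + ρ
on the right. -/
theorem oracle_pathwise {n d : ℕ} (hn : Odd n) {Λ : Finset (Fin n → ℝ)}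
    (hΛ : ∀ lam ∈ Λ, ∀ j, lam j ∈ Icc (0 : ℝ) 1) {ρ σs u v : ℝ} (hρ : 0 < ρ) (hρ3 : ρ < 1 / 3)
    (hu : ∀ lam ∈ Λ, ∀ l, |basisDev 1 n lam l| ≤ u) (hv : ∀ lam ∈ Λ, ∑ j, lam j ≤ v)
    (S : ℝ → ℝ) {s x y : Fin n → ℝ} (hy : y = fun l => S (design n l) + s l * x l)
    (hs0 : ∀ l, 0 < s l) (hs : ∀ l, s l ^ 2 ≤ σs) {lam₀ lam₁ : Fin n → ℝ} (h0 : lam₀ ∈ Λ)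
    (h1 : lam₁ ∈ Λ) (hmin : cost n d ρ y lam₁ ≤ cost n d ρ y lam₀) :
    (1 - 3 * ρ) * loss n S y lam₁ ≤ (1 + ρ) * loss n S y lam₀
      + 2 * ρ * (1 - ρ) * truePenalty n s lam₀ + pathRemainder n d Λ ρ σs u v S lam₀ s x := by
  have hn0 : (0 : ℝ) < n := by exact_mod_cast hn.pos
  have e1 := loss_eq_cost_add hn d ρ S s x lam₁ hy
  have e0 := loss_eq_cost_add hn d ρ S s x lam₀ hy
  have hy' : ∀ j, thetaHat n y j
      = thetaHat n (fun l => S (design n l)) j + thetaHat n (fun l => s l * x l) j := by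
    intro j
    rw [hy, ← thetaHat_add]
  have hc := crossTerm_le hρ (by linarith) (fun l => S (design n l)) (fun l => s l * x l)
    (fun j => lam₁ j - lam₀ j) hy'
  rw [crossTerm_sub] at hc
  have hloss : ∑ j, (lam₁ j - lam₀ j) ^ 2 * thetaHat n y j ^ 2
      ≤ 2 * (loss n S y lam₁ + loss n S y lam₀) := by
    rw [loss_eq_sum hn, loss_eq_sum hn, ← Finset.sum_add_distrib, Finset.mul_sum]
    refine Finset.sum_le_sum fun j _ => ?_
    nlinarith [sq_nonneg (lam₁ j * thetaHat n y j - thetaHat n (fun l => S (design n l)) j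
      + (lam₀ j * thetaHat n y j - thetaHat n (fun l => S (design n l)) j))]
  have hsingle : ∀ f : (Fin n → ℝ) → ℝ, (∀ lam, 0 ≤ f lam) → ∀ lam ∈ Λ, f lam ≤ ∑ lam ∈ Λ, f lam :=
    fun f hf lam hlam => Finset.single_le_sum (fun i _ => hf i) hlam
  have hcr : crossRemainder n ρ (fun l => S (design n l)) (fun l => s l * x l)
      (fun j => lam₁ j - lam₀ j) ≤ ∑ lam ∈ Λ, crossRemainder n ρ (fun l => S (design n l))
        (fun l => s l * x l) (fun j => lam j - lam₀ j) :=
    hsingle (fun lam => crossRemainder n ρ (fun l => S (design n l))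
      (fun l => s l * x l) (fun j => lam j - lam₀ j))
      (fun lam => crossRemainder_nonneg hρ _ _ _) _ h1
  -- Positive volatilities force λ = 0 when the penalty vanishes, so the splitting of the bilinear
  -- term remains valid there.
  have hP : ∀ lam : Fin n → ℝ, truePenalty n s lam = 0 → bilinTerm n lam s x = 0 := by
    intro lam h
    have hm : 0 < meanVar n s := by
      have : Nonempty (Fin n) := ⟨⟨0, hn.pos⟩⟩
      exact mul_pos (by positivity)
        (Finset.sum_pos (fun l _ => pow_pos (hs0 l) 2) Finset.univ_nonempty)
    rw [truePenalty, div_eq_zero_iff, mul_eq_zero] at h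
    have h2 : ∑ j, lam j ^ 2 = 0 := by
      rcases h with (h | h) | h
      · exact h
      · exact absurd h hm.ne'
      · exact absurd h hn0.ne'
    have h3 : ∀ j, lam j = 0 := fun j => pow_eq_zero_iff two_ne_zero |>.mp
      ((Finset.sum_eq_zero_iff_of_nonneg fun j _ => sq_nonneg _).mp h2 j (Finset.mem_univ j))
    simp [bilinTerm, kernel, h3]
  have hb : ∀ lam ∈ Λ, 2 * |bilinTerm n lam s x| ≤ ρ * truePenalty n s lam
      + ∑ lam ∈ Λ, bilinTerm n lam s x ^ 2 / (ρ * truePenalty n s lam) := by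
    intro lam hlam
    refine (two_mul_le_add_sq_div hρ (truePenalty_nonneg n s lam) (hP lam)).trans ?_
    refine add_le_add_right (hsingle
      (fun lam => bilinTerm n lam s x ^ 2 / (ρ * truePenalty n s lam)) (fun lam => ?_) lam hlam) _
    exact div_nonneg (sq_nonneg _) (mul_nonneg hρ.le (truePenalty_nonneg n s lam))
  have hb1 := hb _ h1
  have hb0 := hb _ h0
  have hE : ∀ lam ∈ Λ, |diagTerm n (basisDev 1 n lam) s x|
      ≤ ∑ lam ∈ Λ, |diagTerm n (basisDev 1 n lam) s x| := fun lam hlam =>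
    hsingle (fun lam => |diagTerm n (basisDev 1 n lam) s x|) (fun _ => abs_nonneg _) lam hlam
  have hE1 := hE _ h1
  have hE0 := hE _ h0
  have hC1 := abs_sum_sq_mul_le hn.pos hs (hu _ h1)
  have hC0 := abs_sum_sq_mul_le hn.pos hs (hu _ h0)
  have hsum0 : ∀ lam ∈ Λ, 0 ≤ ∑ j, lam j := fun lam hlam =>
    Finset.sum_nonneg fun j _ => (hΛ lam hlam j).1
  have hsq : ∀ lam ∈ Λ, ∑ j, lam j ^ 2 ≤ v := fun lam hlam =>
    (Finset.sum_le_sum fun j _ => by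
      have := hΛ lam hlam j
      nlinarith [this.1, this.2]).trans (hv lam hlam)
  have hsq0 : ∀ lam : Fin n → ℝ, 0 ≤ ∑ j, lam j ^ 2 := fun lam =>
    Finset.sum_nonneg fun j _ => sq_nonneg _
  have hv0 : 0 ≤ v := (hsq0 _).trans (hsq _ h0)
  have hdiff : |∑ j, lam₁ j - ∑ j, lam₀ j| ≤ v := by
    rw [abs_le]
    constructor <;> linarith [hsum0 _ h0, hsum0 _ h1, hv _ h0, hv _ h1]
  have hD : (∑ j, lam₁ j - ∑ j, lam₀ j) * diagTerm n (fun _ => 1) s x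
      ≤ v * |diagTerm n (fun _ => 1) s x| := by
    refine (le_abs_self _).trans ?_
    rw [abs_mul]
    exact mul_le_mul_of_nonneg_right hdiff (abs_nonneg _)
  set Δ := meanVar n s - varEst n d y with hΔ
  have hV : (∑ j, lam₁ j - ∑ j, lam₀ j) * Δ / n ≤ v / n * |Δ| := by
    rw [mul_div_right_comm, div_mul_eq_mul_div, div_mul_eq_mul_div]
    refine div_le_div_of_nonneg_right ((le_abs_self _).trans ?_) hn0.le
    rw [abs_mul]
    exact mul_le_mul_of_nonneg_right hdiff (abs_nonneg _)
  -- Replacing the estimated penalty by the true one costs at most v/n times |Δ|, since λ(j)² ≤ λ(j)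
  -- on [0, 1].
  have hpen : ∀ lam, truePenalty n s lam - penalty n d y lam = (∑ j, lam j ^ 2) / n * Δ := by
    intro lam
    rw [truePenalty, penalty, hΔ]
    ring
  have hpenb : ∀ lam ∈ Λ, |truePenalty n s lam - penalty n d y lam| ≤ v / n * |Δ| := by
    intro lam hlam
    rw [hpen, abs_mul, abs_of_nonneg (div_nonneg (hsq0 lam) hn0.le)]
    exact mul_le_mul_of_nonneg_right (div_le_div_of_nonneg_right (hsq lam hlam) hn0.le)
      (abs_nonneg _)
  have hp1 := mul_le_mul_of_nonneg_left ((le_abs_self _).trans (hpenb _ h1)) hρ.le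
  have hp0 := mul_le_mul_of_nonneg_left ((neg_abs_le _).trans' (neg_le_neg (hpenb _ h0))) hρ.le
  set M := crossTerm n (fun l => S (design n l)) (fun l => s l * x l) lam₁
    - crossTerm n (fun l => S (design n l)) (fun l => s l * x l) lam₀ with hM
  set R := 4 * (u * σs / n) + 2 * v * |diagTerm n (fun _ => 1) s x|
      + 4 * ∑ lam ∈ Λ, |diagTerm n (basisDev 1 n lam) s x|
      + 2 * ∑ lam ∈ Λ, bilinTerm n lam s x ^ 2 / (ρ * truePenalty n s lam)
      + (2 + 2 * ρ) * (v / n) * |Δ| with hR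
  -- The penalty in the cost cancels the ρP that the bilinear splitting spends at λ₁. At λ₀ the two
  -- add up to 2ρP. The factor 2 + 2ρ of |Δ| collects 2 from the weight sums and ρ from each penalty
  -- replacement.
  have hmain : loss n S y lam₁ ≤ loss n S y lam₀ + 2 * M + 2 * ρ * truePenalty n s lam₀ + R := by
    have g1 := le_abs_self (bilinTerm n lam₁ s x)
    have g0 := neg_abs_le (bilinTerm n lam₀ s x)
    have g2 := le_abs_self (diagTerm n (basisDev 1 n lam₁) s x)
    have g3 := neg_abs_le (diagTerm n (basisDev 1 n lam₀) s x)
    have g4 := (abs_le.mp hC1).2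
    have g5 := (abs_le.mp hC0).1
    have e2 : (∑ j, lam₁ j) * Δ / n - (∑ j, lam₀ j) * Δ / n
        = (∑ j, lam₁ j - ∑ j, lam₀ j) * Δ / n := by ring
    rw [hR, hM]
    linarith
  have hmain' := mul_le_mul_of_nonneg_left hmain (by linarith : 0 ≤ 1 - ρ)
  have hrem : pathRemainder n d Λ ρ σs u v S lam₀ s x = ∑ lam ∈ Λ, crossRemainder n ρ
      (fun l => S (design n l)) (fun l => s l * x l) (fun j => lam j - lam₀ j) + (1 - ρ) * R := by
    rw [hR, hΔ, hy]
    rfl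
  have hloss' := mul_le_mul_of_nonneg_left hloss hρ.le
  rw [hrem]
  linarith

/-! ### Expectations for deterministic volatilities -/

theorem thetaHat_mul_eq (n : ℕ) (s x : Fin n → ℝ) (j : Fin n) :
    thetaHat n (fun l => s l * x l) j
      = ∑ l, (1 / (n : ℝ) * (s l * basisFn n j (design n l))) * x l := by
  rw [thetaHat, Finset.mul_sum]
  exact Finset.sum_congr rfl fun l _ => by ring

theorem crossTerm_eq (n : ℕ) (a c s x : Fin n → ℝ) :
    crossTerm n a (fun l => s l * x l) c
      = ∑ l, (1 / (n : ℝ) * (s l * ∑ j, c j * thetaHat n a j * basisFn n j (design n l))) * x l := by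
  simp only [crossTerm, thetaHat_mul_eq, Finset.mul_sum, Finset.sum_mul]
  rw [Finset.sum_comm]
  exact Finset.sum_congr rfl fun l _ => Finset.sum_congr rfl fun j _ => by ring

theorem sum_kernel_sq {n : ℕ} (hn : Odd n) (c : Fin n → ℝ) (k : Fin n) :
    ∑ l, kernel n c k l ^ 2 = n * ∑ j, c j ^ 2 * basisFn n j (design n k) ^ 2 := by
  simp only [kernel]
  rw [sum_combination_sq hn]
  simp only [mul_pow]

theorem meanVar_le {n : ℕ} (hn : 0 < n) {s : Fin n → ℝ} {σs : ℝ} (hs : ∀ l, s l ^ 2 ≤ σs) :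
    meanVar n s ≤ σs := by
  have hn0 : (0 : ℝ) < n := by exact_mod_cast hn
  have : ∑ l, s l ^ 2 ≤ n * σs := by
    have := Finset.sum_le_sum fun l (_ : l ∈ Finset.univ) => hs l
    rwa [Finset.sum_const, Finset.card_univ, Fintype.card_fin, nsmul_eq_mul] at this
  rw [meanVar, one_div, inv_mul_le_iff₀ hn0]
  exact this

/-- The indicator of the indices beyond `d`. -/
def tailWeight (n d : ℕ) (j : Fin n) : ℝ := if d + 1 ≤ (j : ℕ) + 1 then 1 else 0

theorem tailWeight_sq (n d : ℕ) (j : Fin n) : tailWeight n d j ^ 2 = tailWeight n d j := by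
  unfold tailWeight
  split_ifs <;> norm_num

theorem sum_filter_tail_eq (n d : ℕ) (f : Fin n → ℝ) :
    ∑ j ∈ Finset.univ.filter (fun j : Fin n => d + 1 ≤ (j : ℕ) + 1), f j
      = ∑ j, tailWeight n d j * f j := by
  rw [Finset.sum_filter]
  exact Finset.sum_congr rfl fun j _ => by unfold tailWeight; split_ifs <;> simp

theorem sum_one_sub_tailWeight_le (n d : ℕ) : ∑ j, (1 - tailWeight n d j) ≤ d := by
  have h : ∀ j : Fin n, 1 - tailWeight n d j = (fun i : ℕ => if i < d then (1 : ℝ) else 0) j := by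
    intro j
    simp only [tailWeight]
    by_cases h : (j : ℕ) < d
    · rw [if_neg (by omega), if_pos h, sub_zero]
    · rw [if_pos (by omega), if_neg h, sub_self]
  rw [Finset.sum_congr rfl fun j _ => h j, Fin.sum_univ_eq_sum_range
    (fun i : ℕ => if i < d then (1 : ℝ) else 0), ← Finset.sum_filter, Finset.sum_const,
    nsmul_eq_mul, mul_one]
  have : ((Finset.range n).filter fun i => i < d) ⊆ Finset.range d := by
    intro i hi
    exact Finset.mem_range.mpr (Finset.mem_filter.mp hi).2
  exact_mod_cast (Finset.card_le_card this).trans_eq (Finset.card_range d)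

/-- By completeness the full kernel equals n on the diagonal, and the tail kernel omits at most d
squares, each at most 2. -/
theorem kernel_tailWeight_mem {n d : ℕ} (hn : Odd n) (l : Fin n) :
    0 ≤ kernel n (tailWeight n d) l l ∧ kernel n (tailWeight n d) l l ≤ n ∧
      n - kernel n (tailWeight n d) l l ≤ 2 * d := by
  have h0 : ∀ j : Fin n, 0 ≤ tailWeight n d j := fun j => by
    rw [← tailWeight_sq]; exact sq_nonneg _
  have h1 : ∀ j : Fin n, 0 ≤ 1 - tailWeight n d j := fun j => by
    unfold tailWeight
    split_ifs <;> norm_num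
  have hc := sum_basisFn_mul_design hn l l
  rw [if_pos rfl] at hc
  have hsub : n - kernel n (tailWeight n d) l l
      = ∑ j, (1 - tailWeight n d j) * basisFn n j (design n l) ^ 2 := by
    rw [← hc, kernel, ← Finset.sum_sub_distrib]
    exact Finset.sum_congr rfl fun j _ => by ring
  refine ⟨Finset.sum_nonneg fun j _ => ?_, ?_, ?_⟩
  · rw [mul_assoc]
    exact mul_nonneg (h0 j) (mul_self_nonneg _)
  · rw [← sub_nonneg, hsub]
    exact Finset.sum_nonneg fun j _ => mul_nonneg (h1 j) (sq_nonneg _)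
  · rw [hsub]
    calc _ ≤ ∑ j, (1 - tailWeight n d j) * 2 := Finset.sum_le_sum fun j _ =>
          mul_le_mul_of_nonneg_left (basisFn_sq_le n j _) (h1 j)
      _ ≤ 2 * d := by
          rw [← Finset.sum_mul]
          linarith [sum_one_sub_tailWeight_le n d]

theorem varEst_eq (n d : ℕ) (a s x : Fin n → ℝ) :
    varEst n d (fun l => a l + s l * x l) = signalNormSq n a (tailWeight n d)
      + 2 * crossTerm n a (fun l => s l * x l) (tailWeight n d)
      + (bilinTerm n (tailWeight n d) s x
        + diagTerm n (fun l => kernel n (tailWeight n d) l l) s x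
        + 1 / (n : ℝ) ^ 2 * ∑ l, s l ^ 2 * kernel n (tailWeight n d) l l) := by
  rw [← sum_mul_thetaHat_sq_eq, varEst, sum_filter_tail_eq, signalNormSq, crossTerm,
    Finset.mul_sum, ← Finset.sum_add_distrib, ← Finset.sum_add_distrib]
  refine Finset.sum_congr rfl fun j _ => ?_
  rw [thetaHat_add, tailWeight_sq]
  ring

/-- The deterministic bias consists of the signal's tail energy and of the at most d omitted noise
coefficients; the rest are the absolute values of the centred forms. -/
theorem abs_meanVar_sub_varEst_le {n d : ℕ} (hn : Odd n) (a s x : Fin n → ℝ) {σs : ℝ}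
    (hs : ∀ l, s l ^ 2 ≤ σs) :
    |meanVar n s - varEst n d (fun l => a l + s l * x l)|
      ≤ signalNormSq n a (tailWeight n d) + 2 * d * σs / n
        + (2 * |crossTerm n a (fun l => s l * x l) (tailWeight n d)|
        + (|bilinTerm n (tailWeight n d) s x|
        + |diagTerm n (fun l => kernel n (tailWeight n d) l l) s x|)) := by
  have hn0 : (n : ℝ) ≠ 0 := by exact_mod_cast hn.pos.ne'
  have e : meanVar n s - 1 / (n : ℝ) ^ 2 * ∑ l, s l ^ 2 * kernel n (tailWeight n d) l l
      = 1 / (n : ℝ) ^ 2 * ∑ l, s l ^ 2 * (n - kernel n (tailWeight n d) l l) := by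
    simp only [meanVar, mul_sub, Finset.sum_sub_distrib, ← Finset.sum_mul]
    field_simp
  have h1 := abs_sum_sq_mul_le (w := fun l => n - kernel n (tailWeight n d) l l) (u := 2 * d)
    hn.pos hs fun l => by
      have := kernel_tailWeight_mem (d := d) hn l
      rw [abs_of_nonneg (by linarith)]
      exact this.2.2
  rw [← e] at h1
  have h0 := signalNormSq_nonneg n a (tailWeight n d)
  have g1 := abs_le.mp h1
  have g2 := abs_le.mp (le_refl |crossTerm n a (fun l => s l * x l) (tailWeight n d)|)
  have g3 := abs_le.mp (le_refl |bilinTerm n (tailWeight n d) s x|)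
  have g4 := abs_le.mp (le_refl |diagTerm n (fun l => kernel n (tailWeight n d) l l) s x|)
  rw [varEst_eq, abs_le]
  constructor <;> linarith [g1.1, g1.2, g2.1, g2.2, g3.1, g3.2, g4.1, g4.2]

namespace NoiseModel

variable {Ω : Type*} [MeasurableSpace Ω] {μ : Measure Ω} [IsProbabilityMeasure μ] {n : ℕ}
  {σ ξ : Fin n → Ω → ℝ} {σs ξs : ℝ} {s : Fin n → ℝ}

theorem memLp_crossTerm (h : NoiseModel μ n σ ξ σs ξs) (s a c : Fin n → ℝ) :
    MemLp (fun ω => crossTerm n a (fun l => s l * ξ l ω) c) 2 μ := by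
  have e : (fun ω => crossTerm n a (fun l => s l * ξ l ω) c) = _ :=
    funext fun ω => crossTerm_eq n a c s fun l => ξ l ω
  rw [e]
  exact h.memLp_linear _

theorem integral_crossTerm (h : NoiseModel μ n σ ξ σs ξs) (s a c : Fin n → ℝ) :
    ∫ ω, crossTerm n a (fun l => s l * ξ l ω) c ∂μ = 0 := by
  have e : ∀ ω, crossTerm n a (fun l => s l * ξ l ω) c = _ :=
    fun ω => crossTerm_eq n a c s fun l => ξ l ω
  simp only [e]
  exact h.integral_linear _

theorem integral_crossTerm_sq_le (h : NoiseModel μ n σ ξ σs ξs) (hn : Odd n)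
    (hs : ∀ l, s l ^ 2 ≤ σs) (a c : Fin n → ℝ) :
    ∫ ω, crossTerm n a (fun l => s l * ξ l ω) c ^ 2 ∂μ ≤ σs / n * signalNormSq n a c := by
  have hn0 : (0 : ℝ) < n := by exact_mod_cast hn.pos
  have e : ∀ ω, crossTerm n a (fun l => s l * ξ l ω) c = _ :=
    fun ω => crossTerm_eq n a c s fun l => ξ l ω
  simp only [e]
  rw [h.integral_linear_sq]
  calc ∑ l, (1 / (n : ℝ) * (s l * ∑ j, c j * thetaHat n a j * basisFn n j (design n l))) ^ 2
      ≤ ∑ l, σs / n ^ 2 * (∑ j, c j * thetaHat n a j * basisFn n j (design n l)) ^ 2 := by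
        refine Finset.sum_le_sum fun l _ => ?_
        rw [mul_pow, mul_pow, ← mul_assoc]
        refine mul_le_mul_of_nonneg_right ?_ (sq_nonneg _)
        rw [one_div, inv_pow, inv_mul_eq_div]
        exact div_le_div_of_nonneg_right (hs l) (by positivity)
    _ = σs / n * signalNormSq n a c := by
        rw [← Finset.mul_sum, sum_combination_sq hn, signalNormSq]
        simp only [mul_pow]
        field_simp

theorem integrable_crossRemainder (h : NoiseModel μ n σ ξ σs ξs) (ρ : ℝ) (s a c : Fin n → ℝ) :
    Integrable (fun ω => crossRemainder n ρ a (fun l => s l * ξ l ω) c) μ :=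
  ((h.memLp_crossTerm s a _).integrable_sq.div_const _).add
    ((h.memLp_crossTerm s a _).integrable_sq.div_const _)

/-- Both denominators are deterministic and match the variance of the linear form, so θ drops out.
The bound |c_j| ≤ 1 lets the energy of c also dominate that of c². -/
theorem integral_crossRemainder_le (h : NoiseModel μ n σ ξ σs ξs) (hn : Odd n) (hσs : 0 ≤ σs)
    (hs : ∀ l, s l ^ 2 ≤ σs) {ρ : ℝ} (hρ : 0 < ρ) (hρ1 : ρ ≤ 1) (a : Fin n → ℝ) {c : Fin n → ℝ}
    (hc : ∀ j, |c j| ≤ 1) :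
    ∫ ω, crossRemainder n ρ a (fun l => s l * ξ l ω) c ∂μ ≤ 2 * σs / (ρ * n) := by
  have hn0 : (0 : ℝ) < n := by exact_mod_cast hn.pos
  simp only [crossRemainder]
  rw [integral_add ((h.memLp_crossTerm s a _).integrable_sq.div_const _)
    ((h.memLp_crossTerm s a _).integrable_sq.div_const _), integral_div, integral_div]
  have hA := signalNormSq_nonneg n a c
  have h1 := h.integral_crossTerm_sq_le hn hs a c
  have h2 := h.integral_crossTerm_sq_le hn hs a (fun j => c j ^ 2)
  have h3 : signalNormSq n a (fun j => c j ^ 2) ≤ signalNormSq n a c := by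
    refine Finset.sum_le_sum fun j _ => mul_le_mul_of_nonneg_right ?_ (sq_nonneg _)
    have h4 : c j ^ 2 ≤ 1 := (sq_le_one_iff_abs_le_one _).mpr (hc j)
    nlinarith [sq_nonneg (c j)]
  have h5 : (∫ ω, crossTerm n a (fun l => s l * ξ l ω) (fun j => c j ^ 2) ^ 2 ∂μ)
      / signalNormSq n a c ≤ σs / n :=
    div_le_of_le_mul₀ hA (by positivity) (h2.trans (mul_le_mul_of_nonneg_left h3 (by positivity)))
  have h6 : (∫ ω, crossTerm n a (fun l => s l * ξ l ω) c ^ 2 ∂μ)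
      / (ρ * signalNormSq n a c) ≤ σs / (ρ * n) := by
    refine div_le_of_le_mul₀ (mul_nonneg hρ.le hA) (by positivity) (h1.trans_eq ?_)
    field_simp
  have h7 : σs / n ≤ σs / (ρ * n) :=
    div_le_div_of_nonneg_left hσs (by positivity) (mul_le_of_le_one_left hn0.le hρ1)
  calc _ ≤ σs / (ρ * n) + σs / (ρ * n) := add_le_add (h5.trans h7) h6
    _ = 2 * σs / (ρ * n) := by ring

theorem memLp_bilinTerm (h : NoiseModel μ n σ ξ σs ξs) (c s : Fin n → ℝ) :
    MemLp (fun ω => bilinTerm n c s fun l => ξ l ω) 2 μ :=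
  h.memLp_bilinear fun p => 1 / (n : ℝ) ^ 2 * (2 * (s p.1 * s p.2 * kernel n c p.1 p.2))

/-- The sum over pairs is at most half the full double sum. Orthogonality evaluates Σ_l K(k,l)² as n
Σ_j c_j² φ_j(x_k)², and φ_j² ≤ 2 bounds it. One factor s² is kept rather than bounded by σ_*, so
that the true penalty appears and cancels the denominator in the remainder. -/
theorem integral_bilinTerm_sq_le (h : NoiseModel μ n σ ξ σs ξs) (hn : Odd n) (hσs : 0 ≤ σs)
    (hs : ∀ l, s l ^ 2 ≤ σs) (c : Fin n → ℝ) :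
    ∫ ω, (bilinTerm n c s fun l => ξ l ω) ^ 2 ∂μ ≤ 4 * σs / n * truePenalty n s c := by
  have hn0 : (0 : ℝ) < n := by exact_mod_cast hn.pos
  have e := h.integral_bilinear_sq
    fun p => 1 / (n : ℝ) ^ 2 * (2 * (s p.1 * s p.2 * kernel n c p.1 p.2))
  simp only [bilinTerm]
  rw [e]
  have e2 : ∑ p ∈ orderedPairs n, (1 / (n : ℝ) ^ 2 * (2 * (s p.1 * s p.2 * kernel n c p.1 p.2))) ^ 2
      = 2 / (n : ℝ) ^ 4 * (2 * ∑ p ∈ orderedPairs n,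
        (fun k l => s k ^ 2 * (s l ^ 2 * kernel n c k l ^ 2)) p.1 p.2) := by
    rw [Finset.mul_sum, Finset.mul_sum]
    exact Finset.sum_congr rfl fun p _ => by ring
  have e3 := sum_sum_eq_diag_add (fun k l => s k ^ 2 * (s l ^ 2 * kernel n c k l ^ 2))
    fun k l => by rw [kernel_comm n c k l]; ring
  have h0 : 0 ≤ ∑ l, s l ^ 2 * (s l ^ 2 * kernel n c l l ^ 2) :=
    Finset.sum_nonneg fun l _ => by positivity
  have h1 : ∑ k, ∑ l, s k ^ 2 * (s l ^ 2 * kernel n c k l ^ 2)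
      ≤ ∑ k, s k ^ 2 * (σs * (n * (2 * ∑ j, c j ^ 2))) := by
    refine Finset.sum_le_sum fun k _ => ?_
    rw [← Finset.mul_sum]
    refine mul_le_mul_of_nonneg_left ?_ (sq_nonneg _)
    calc ∑ l, s l ^ 2 * kernel n c k l ^ 2 ≤ ∑ l, σs * kernel n c k l ^ 2 :=
          Finset.sum_le_sum fun l _ => mul_le_mul_of_nonneg_right (hs l) (sq_nonneg _)
      _ = σs * (n * ∑ j, c j ^ 2 * basisFn n j (design n k) ^ 2) := by
          rw [← Finset.mul_sum, sum_kernel_sq hn]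
      _ ≤ _ := by
          refine mul_le_mul_of_nonneg_left (mul_le_mul_of_nonneg_left ?_ hn0.le) hσs
          rw [Finset.mul_sum]
          refine Finset.sum_le_sum fun j _ => ?_
          rw [mul_comm]
          exact mul_le_mul_of_nonneg_right (basisFn_sq_le n j _) (sq_nonneg _)
  rw [e2]
  calc _ ≤ 2 / (n : ℝ) ^ 4 * ∑ k, s k ^ 2 * (σs * (n * (2 * ∑ j, c j ^ 2))) :=
        mul_le_mul_of_nonneg_left (by linarith) (by positivity)
    _ = 4 * σs / n * truePenalty n s c := by
        rw [← Finset.sum_mul, truePenalty, meanVar]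
        field_simp
        ring

theorem memLp_diagTerm (h : NoiseModel μ n σ ξ σs ξs) (w s : Fin n → ℝ) :
    MemLp (fun ω => diagTerm n w s fun l => ξ l ω) 2 μ :=
  h.memLp_diagonal fun l => 1 / (n : ℝ) ^ 2 * (s l ^ 2 * w l)

theorem integral_abs_diagTerm_le (h : NoiseModel μ n σ ξ σs ξs) (hn : Odd n) (hσs : 0 ≤ σs)
    (hs : ∀ l, s l ^ 2 ≤ σs) {w : Fin n → ℝ} {u : ℝ} (hu : 0 ≤ u) (hw : ∀ l, |w l| ≤ u) :
    ∫ ω, |diagTerm n w s fun l => ξ l ω| ∂μ ≤ u * σs * (√ξs / √n) / n := by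
  have hn0 : (0 : ℝ) < n := by exact_mod_cast hn.pos
  have hξ : 0 ≤ ξs := by
    rw [← h.fourth_moment_xi ⟨0, hn.pos⟩]
    exact integral_nonneg fun ω => by positivity
  refine (integral_abs_le_sqrt (h.memLp_diagTerm w s)
    (v := ξs / n * (u * σs / n) ^ 2) ?_).trans_eq ?_
  · have := h.integral_diagonal_sq_le fun l => 1 / (n : ℝ) ^ 2 * (s l ^ 2 * w l)
    refine this.trans ?_
    have hle : ∑ l, (1 / (n : ℝ) ^ 2 * (s l ^ 2 * w l)) ^ 2
        ≤ ∑ _l : Fin n, (1 / (n : ℝ) ^ 2 * (σs * u)) ^ 2 := by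
      refine Finset.sum_le_sum fun l _ => ?_
      rw [← sq_abs, abs_mul, abs_mul, abs_of_nonneg (by positivity : (0 : ℝ) ≤ 1 / (n : ℝ) ^ 2),
        abs_of_nonneg (sq_nonneg (s l))]
      gcongr
      · exact hs l
      · exact hw l
    rw [Finset.sum_const, Finset.card_univ, Fintype.card_fin, nsmul_eq_mul] at hle
    refine (mul_le_mul_of_nonneg_left hle hξ).trans_eq ?_
    field_simp
  · rw [Real.sqrt_mul (by positivity), Real.sqrt_sq (by positivity), Real.sqrt_div hξ]
    ring

/-- The risk is the squared bias plus the mean of Σ λ(j)² η_j², and the latter equals the true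
penalty up to the deviation bounded by u_2. -/
theorem integral_truePenalty_sub_loss_le (h : NoiseModel μ n σ ξ σs ξs) (hn : Odd n)
    (hs : ∀ l, s l ^ 2 ≤ σs) (S : ℝ → ℝ) {lam : Fin n → ℝ} {u : ℝ}
    (hu : ∀ l, |basisDev 2 n lam l| ≤ u) :
    ∫ ω, (truePenalty n s lam - loss n S (fun l => S (design n l) + s l * ξ l ω) lam) ∂μ
      ≤ u * σs / n := by
  have hn0 : (0 : ℝ) < n := by exact_mod_cast hn.pos
  set a : Fin n → ℝ := fun l => S (design n l) with ha
  have e : ∀ ω, truePenalty n s lam - loss n S (fun l => S (design n l) + s l * ξ l ω) lam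
      = (truePenalty n s lam - signalNormSq n a fun j => lam j - 1)
        - (2 * crossTerm n a (fun l => s l * ξ l ω) (fun j => (lam j - 1) * lam j)
          + ∑ j, lam j ^ 2 * thetaHat n (fun l => s l * ξ l ω) j ^ 2) := by
    intro ω
    have e1 : loss n S (fun l => S (design n l) + s l * ξ l ω) lam
        = (signalNormSq n a fun j => lam j - 1)
        + (2 * crossTerm n a (fun l => s l * ξ l ω) (fun j => (lam j - 1) * lam j)
          + ∑ j, lam j ^ 2 * thetaHat n (fun l => s l * ξ l ω) j ^ 2) := by
      rw [loss_eq_sum hn, signalNormSq, crossTerm, Finset.mul_sum, ← Finset.sum_add_distrib,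
        ← Finset.sum_add_distrib]
      refine Finset.sum_congr rfl fun j _ => ?_
      rw [thetaHat_add]
      ring
    rw [e1]
    ring
  have hth : ∀ j, MemLp (fun ω => thetaHat n (fun l => s l * ξ l ω) j) 2 μ := by
    intro j
    have : (fun ω => thetaHat n (fun l => s l * ξ l ω) j) = _ :=
      funext fun ω => thetaHat_mul_eq n s (fun l => ξ l ω) j
    rw [this]
    exact h.memLp_linear _
  have hths : ∀ j, ∫ ω, thetaHat n (fun l => s l * ξ l ω) j ^ 2 ∂μ
      = ∑ l, (1 / (n : ℝ) * (s l * basisFn n j (design n l))) ^ 2 := by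
    intro j
    have : ∀ ω, thetaHat n (fun l => s l * ξ l ω) j = _ :=
      fun ω => thetaHat_mul_eq n s (fun l => ξ l ω) j
    simp only [this]
    exact h.integral_linear_sq _
  have i1 : Integrable (fun ω => 2 * crossTerm n a (fun l => s l * ξ l ω)
      (fun j => (lam j - 1) * lam j)) μ :=
    ((h.memLp_crossTerm s a _).integrable (by norm_num)).const_mul 2
  have i2 : ∀ j ∈ Finset.univ,
      Integrable (fun ω => lam j ^ 2 * thetaHat n (fun l => s l * ξ l ω) j ^ 2) μ :=
    fun j _ => (hth j).integrable_sq.const_mul _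
  have i3 : Integrable (fun ω => ∑ j, lam j ^ 2 * thetaHat n (fun l => s l * ξ l ω) j ^ 2) μ :=
    integrable_finsetSum _ i2
  simp only [e]
  rw [integral_sub (integrable_const _) (i1.fun_add i3), integral_add i1 i3, integral_const_mul,
    h.integral_crossTerm, integral_finsetSum _ i2, integral_const]
  simp only [probReal_univ, one_smul, integral_const_mul, hths, mul_zero, zero_add]
  have e4 : ∑ j, lam j ^ 2 * ∑ l, (1 / (n : ℝ) * (s l * basisFn n j (design n l))) ^ 2
      = truePenalty n s lam + 1 / (n : ℝ) ^ 2 * ∑ l, s l ^ 2 * basisDev 2 n lam l := by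
    have : truePenalty n s lam = 1 / (n : ℝ) ^ 2 * ∑ l, s l ^ 2 * ∑ j, lam j ^ 2 := by
      rw [truePenalty, meanVar, ← Finset.sum_mul]
      ring
    rw [this, ← mul_add, ← Finset.sum_add_distrib]
    simp only [basisDev, ← mul_add, ← Finset.sum_add_distrib]
    simp only [Finset.mul_sum]
    rw [Finset.sum_comm]
    exact Finset.sum_congr rfl fun l _ => Finset.sum_congr rfl fun j _ => by ring
  rw [e4]
  have h5 := (abs_le.mp (abs_sum_sq_mul_le hn.pos hs hu)).1
  have h6 := signalNormSq_nonneg n a fun j => lam j - 1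
  linarith

/-- The rate at which the noise variance is estimated. -/
theorem integral_abs_meanVar_sub_varEst_le (h : NoiseModel μ n σ ξ σs ξs) (hn : Odd n)
    (hσs : 0 ≤ σs) (hs : ∀ l, s l ^ 2 ≤ σs) {S : ℝ → ℝ} {r : ℝ} (hr : 0 ≤ r)
    (hS : S ∈ sobolevBall 1 r) {d : ℕ} (hd : 1 ≤ d) :
    Integrable (fun ω => |meanVar n s - varEst n d (fun l => S (design n l) + s l * ξ l ω)|) μ ∧
    ∫ ω, |meanVar n s - varEst n d (fun l => S (design n l) + s l * ξ l ω)| ∂μ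
      ≤ 2 * ((2 * (√ξs + √2) * σs + varStar n d σs r) / √n) := by
  have hn0 : (0 : ℝ) < n := by exact_mod_cast hn.pos
  have hd0 : (0 : ℝ) < d := by exact_mod_cast hd
  set a : Fin n → ℝ := fun l => S (design n l) with ha
  set c := tailWeight n d with hc
  have i1 := h.memLp_crossTerm s a c
  have i2 := h.memLp_bilinTerm c s
  have i3 := h.memLp_diagTerm (fun l => kernel n c l l) s
  have j1 := (i1.integrable (by norm_num)).abs.const_mul 2
  have j2 := (i2.integrable (by norm_num)).abs
  have j3 := (i3.integrable (by norm_num)).abs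
  have jj : Integrable (fun ω => signalNormSq n a c + 2 * d * σs / n
        + (2 * |crossTerm n a (fun l => s l * ξ l ω) c|
        + (|bilinTerm n c s fun l => ξ l ω|
        + |diagTerm n (fun l => kernel n c l l) s fun l => ξ l ω|))) μ :=
    (integrable_const _).add (j1.add (j2.add j3))
  have hint : Integrable
      (fun ω => |meanVar n s - varEst n d (fun l => S (design n l) + s l * ξ l ω)|) μ := by
    have e : ∀ ω, varEst n d (fun l => S (design n l) + s l * ξ l ω) = _ :=
      fun ω => varEst_eq n d a s fun l => ξ l ω
    simp only [e]
    exact ((integrable_const _).sub (((integrable_const _).add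
      ((i1.integrable (by norm_num)).const_mul 2)).add
      (((i2.integrable (by norm_num)).add (i3.integrable (by norm_num))).add
        (integrable_const _)))).abs
  refine ⟨hint, ?_⟩
  have hA : signalNormSq n a c ≤ r / (4 * (d : ℝ) ^ 2) := by
    have := sum_tail_thetaHat_sq_le_of_mem_sobolevBall hn hS hd
    rw [sum_filter_tail_eq] at this
    simpa only [signalNormSq, hc, tailWeight_sq] using this
  have k1 : ∫ ω, |crossTerm n a (fun l => s l * ξ l ω) c| ∂μ ≤ √(r * σs) / (2 * d) / √n := by
    refine (integral_abs_le_sqrt i1 ((h.integral_crossTerm_sq_le hn hs a c).trans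
      (mul_le_mul_of_nonneg_left hA (by positivity)))).trans_eq ?_
    have : σs / n * (r / (4 * (d : ℝ) ^ 2)) = r * σs / (2 * d) ^ 2 / n := by
      field_simp
      ring
    rw [this, Real.sqrt_div (by positivity), Real.sqrt_div (by positivity),
      Real.sqrt_sq (by positivity)]
  have k2 : ∫ ω, |bilinTerm n c s fun l => ξ l ω| ∂μ ≤ 2 * σs / √n := by
    have hP : truePenalty n s c ≤ σs := by
      have h1 : ∑ j, c j ^ 2 ≤ n := by
        have : ∑ j, c j ^ 2 ≤ ∑ _j : Fin n, (1 : ℝ) := Finset.sum_le_sum fun j _ => by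
          rw [hc, tailWeight_sq]
          unfold tailWeight
          split_ifs <;> norm_num
        simpa using this
      rw [truePenalty, div_le_iff₀ hn0, mul_comm σs]
      exact mul_le_mul h1 (meanVar_le hn.pos hs) (meanVar_nonneg n s) hn0.le
    refine (integral_abs_le_sqrt i2 ((h.integral_bilinTerm_sq_le hn hσs hs c).trans
      (mul_le_mul_of_nonneg_left hP (by positivity)))).trans_eq ?_
    have : 4 * σs / n * σs = (2 * σs) ^ 2 / n := by ring
    rw [this, Real.sqrt_div (by positivity), Real.sqrt_sq (by positivity)]
  have k3 : ∫ ω, |diagTerm n (fun l => kernel n c l l) s fun l => ξ l ω| ∂μ ≤ σs * √ξs / √n := by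
    refine (h.integral_abs_diagTerm_le hn hσs hs hn0.le fun l => ?_).trans_eq ?_
    · have := kernel_tailWeight_mem (d := d) hn l
      rw [abs_of_nonneg this.1]
      exact this.2.1
    · field_simp
  refine (integral_mono hint jj fun ω => abs_meanVar_sub_varEst_le hn a s _ hs).trans ?_
  rw [integral_add (integrable_const _) (j1.fun_add (j2.fun_add j3)),
    integral_add j1 (j2.fun_add j3),
    integral_add j2 j3, integral_const_mul, integral_const]
  simp only [probReal_univ, one_smul]
  have hq : (0 : ℝ) < √n := Real.sqrt_pos.mpr hn0
  have hqq : √(n : ℝ) * √n = n := Real.mul_self_sqrt hn0.le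
  -- The claimed rate is generous: of these terms only the bias 2dσ_*/n is matched exactly. The
  -- outer factor 2 is what turns (1 - ρ)(2 + 2ρ) into the numerator of `kappa`.
  have e1 : 2 * ((2 * (√ξs + √2) * σs + varStar n d σs r) / √n)
      = 4 * (σs * √ξs / √n) + 4 * √2 * σs / √n + 8 * r / (d : ℝ) ^ 2
        + 8 * √(r * σs) / d / √n + 4 * σs / n + 2 * d * σs / n := by
    rw [varStar]
    generalize √(n : ℝ) = q at hq hqq ⊢
    rw [← hqq]
    field_simp
    ring
  have h2 : 1 ≤ √(2 : ℝ) := Real.one_le_sqrt.mpr (by norm_num)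
  have m1 : 2 * σs / √n ≤ 4 * √2 * σs / √n := by
    refine div_le_div_of_nonneg_right ?_ hq.le
    nlinarith
  have m2 : r / (4 * (d : ℝ) ^ 2) ≤ 8 * r / (d : ℝ) ^ 2 := by
    have : 0 ≤ r / (d : ℝ) ^ 2 := by positivity
    have e : r / (4 * (d : ℝ) ^ 2) = r / (d : ℝ) ^ 2 / 4 := by field_simp
    rw [e, mul_div_assoc]
    linarith
  have m3 : 2 * (√(r * σs) / (2 * d) / √n) ≤ 8 * √(r * σs) / d / √n := by
    have : 0 ≤ √(r * σs) / d / √n := by positivity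
    have e : 2 * (√(r * σs) / (2 * d) / √n) = √(r * σs) / d / √n := by field_simp
    have e' : 8 * √(r * σs) / d / √n = 8 * (√(r * σs) / d / √n) := by ring
    rw [e, e']
    linarith
  have m4 : 0 ≤ 4 * σs / n := by positivity
  have m5 : 0 ≤ σs * √ξs / √n := by positivity
  rw [e1]
  linarith

end NoiseModel

/-! ### Integrating out the volatilities -/

theorem measurable_loss {α : Type*} [MeasurableSpace α] (n : ℕ) (S : ℝ → ℝ)
    {y lam : α → Fin n → ℝ} (hy : Measurable y) (hlam : Measurable lam) :
    Measurable fun t => loss n S (y t) (lam t) := by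
  have hy' : ∀ l, Measurable fun t => y t l := fun l => (measurable_pi_apply l).comp hy
  have hlam' : ∀ l, Measurable fun t => lam t l := fun l => (measurable_pi_apply l).comp hlam
  unfold loss empNormSq wlsEst thetaHat
  fun_prop

theorem measurable_truePenalty (n : ℕ) (lam : Fin n → ℝ) :
    Measurable fun s : Fin n → ℝ => truePenalty n s lam := by
  unfold truePenalty meanVar
  fun_prop

theorem measurable_pathRemainder (n d : ℕ) (Λ : Finset (Fin n → ℝ)) (ρ σs u v : ℝ) (S : ℝ → ℝ)
    (lam₀ : Fin n → ℝ) : Measurable fun p : (Fin n → ℝ) × (Fin n → ℝ) =>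
      pathRemainder n d Λ ρ σs u v S lam₀ p.1 p.2 := by
  have hm : ∀ w : Fin n → ℝ, Measurable fun p : (Fin n → ℝ) × (Fin n → ℝ) =>
      diagTerm n w p.1 p.2 := by
    intro w
    unfold diagTerm
    fun_prop
  have hb : ∀ lam : Fin n → ℝ, Measurable fun p : (Fin n → ℝ) × (Fin n → ℝ) =>
      bilinTerm n lam p.1 p.2 := by
    intro w
    unfold bilinTerm
    fun_prop
  have hP : ∀ lam : Fin n → ℝ, Measurable fun p : (Fin n → ℝ) × (Fin n → ℝ) =>
      truePenalty n p.1 lam := fun lam => (measurable_truePenalty n lam).comp measurable_fst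
  have hc : ∀ c : Fin n → ℝ, Measurable fun p : (Fin n → ℝ) × (Fin n → ℝ) =>
      crossTerm n (fun l => S (design n l)) (fun l => p.1 l * p.2 l) c := by
    intro c
    unfold crossTerm thetaHat
    fun_prop
  have hr : ∀ c : Fin n → ℝ, Measurable fun p : (Fin n → ℝ) × (Fin n → ℝ) =>
      crossRemainder n ρ (fun l => S (design n l)) (fun l => p.1 l * p.2 l) c := by
    intro c
    unfold crossRemainder
    exact (((hc _).pow_const 2).div_const _).add (((hc _).pow_const 2).div_const _)
  have hv : Measurable fun p : (Fin n → ℝ) × (Fin n → ℝ) =>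
      |meanVar n p.1 - varEst n d (fun l => S (design n l) + p.1 l * p.2 l)| := by
    unfold meanVar varEst thetaHat
    refine Measurable.abs ?_
    fun_prop
  unfold pathRemainder
  refine (Finset.measurable_fun_sum _ fun lam _ => hr _).add (Measurable.const_mul ?_ _)
  refine ((((measurable_const).add ((hm _).abs.const_mul _)).add
    ((Finset.measurable_fun_sum _ fun lam _ => (hm _).abs).const_mul _)).add
    ((Finset.measurable_fun_sum _ fun lam _ => ?_).const_mul _)).add (hv.const_mul _)
  exact ((hb lam).pow_const 2).div ((hP lam).const_mul ρ)

/-- The values of the volatilities allowed by the noise model. -/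
def admissible (n : ℕ) (σs : ℝ) : Set (Fin n → ℝ) := {s | ∀ l, 0 < s l ∧ s l ^ 2 ≤ σs}

theorem measurableSet_admissible (n : ℕ) (σs : ℝ) : MeasurableSet (admissible n σs) := by
  have : admissible n σs = ⋂ l, {s | 0 < s l} ∩ {s | s l ^ 2 ≤ σs} := by
    ext s
    simp [admissible]
  rw [this]
  refine MeasurableSet.iInter fun l => ?_
  exact (measurableSet_lt measurable_const (measurable_pi_apply l)).inter
    (measurableSet_le ((measurable_pi_apply l).pow_const 2) measurable_const)

namespace NoiseModel

variable {Ω : Type*} [MeasurableSpace Ω] {μ : Measure Ω} {n : ℕ}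
  {σ ξ : Fin n → Ω → ℝ} {σs ξs : ℝ}

theorem measurable_sigma_vec (h : NoiseModel μ n σ ξ σs ξs) : Measurable fun ω l => σ l ω :=
  measurable_pi_lambda _ h.measurable_sigma

theorem measurable_xi_vec (h : NoiseModel μ n σ ξ σs ξs) : Measurable fun ω l => ξ l ω :=
  measurable_pi_lambda _ h.measurable_xi

theorem ae_admissible (h : NoiseModel μ n σ ξ σs ξs) :
    ∀ᵐ s ∂(μ.map fun ω l => σ l ω), s ∈ admissible n σs := by
  refine (ae_map_iff (p := fun s => s ∈ admissible n σs) h.measurable_sigma_vec.aemeasurable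
    (measurableSet_admissible n σs)).mpr ?_
  filter_upwards [h.sigma_pos, h.sigma_sq_le] with ω h1 h2
  exact fun l => ⟨h1 l, h2 l⟩

variable [IsProbabilityMeasure μ]

theorem map_sigma_xi (h : NoiseModel μ n σ ξ σs ξs) :
    μ.map (fun ω => ((fun l => σ l ω), fun l => ξ l ω))
      = (μ.map fun ω l => σ l ω).prod (μ.map fun ω l => ξ l ω) :=
  (indepFun_iff_map_prod_eq_prod_map_map h.measurable_sigma_vec.aemeasurable
    h.measurable_xi_vec.aemeasurable).mp h.indep_sigma_xi

/-- Independence makes the joint law a product, so Fubini freezes the volatilities at almost surely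
admissible values. The uniform constant C then survives averaging over them. -/
theorem integral_le_of_forall_admissible (h : NoiseModel μ n σ ξ σs ξs)
    {f : (Fin n → ℝ) × (Fin n → ℝ) → ℝ} (hf : Measurable f) {C : ℝ}
    (hint : Integrable (fun ω => f ((fun l => σ l ω), fun l => ξ l ω)) μ)
    (hC : ∀ s ∈ admissible n σs, ∫ ω, f (s, fun l => ξ l ω) ∂μ ≤ C) :
    ∫ ω, f ((fun l => σ l ω), fun l => ξ l ω) ∂μ ≤ C := by
  have hp := h.measurable_sigma_vec.prodMk h.measurable_xi_vec
  have : IsProbabilityMeasure (μ.map fun ω l => σ l ω) :=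
    Measure.isProbabilityMeasure_map h.measurable_sigma_vec.aemeasurable
  have : IsProbabilityMeasure (μ.map fun ω l => ξ l ω) :=
    Measure.isProbabilityMeasure_map h.measurable_xi_vec.aemeasurable
  have hint' := (integrable_map_measure hf.aestronglyMeasurable hp.aemeasurable).mpr hint
  rw [h.map_sigma_xi] at hint'
  have e : ∫ ω, f ((fun l => σ l ω), fun l => ξ l ω) ∂μ
      = ∫ p, f p ∂(μ.map fun ω => ((fun l => σ l ω), fun l => ξ l ω)) :=
    (integral_map hp.aemeasurable hf.aestronglyMeasurable).symm
  rw [e, h.map_sigma_xi, integral_prod _ hint']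
  have hC' : (∫ _s, C ∂(μ.map fun ω l => σ l ω)) = C := by simp
  rw [← hC']
  refine integral_mono_ae hint'.integral_prod_left (integrable_const _) ?_
  filter_upwards [h.ae_admissible] with s hs
  have e2 : ∫ y, f (s, y) ∂(μ.map fun ω l => ξ l ω) = ∫ ω, f (s, fun l => ξ l ω) ∂μ :=
    integral_map h.measurable_xi_vec.aemeasurable
      (hf.comp measurable_prodMk_left).aestronglyMeasurable
  rw [e2]
  exact hC s hs

/-- The Tonelli counterpart: for nonnegative f, the uniform bound on the inner integrals also gives
joint integrability. -/
theorem integrable_of_forall_admissible (h : NoiseModel μ n σ ξ σs ξs)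
    {f : (Fin n → ℝ) × (Fin n → ℝ) → ℝ} (hf : Measurable f) {C : ℝ}
    (h0 : ∀ p, 0 ≤ f p)
    (hint : ∀ s ∈ admissible n σs, Integrable (fun ω => f (s, fun l => ξ l ω)) μ)
    (hC : ∀ s ∈ admissible n σs, ∫ ω, f (s, fun l => ξ l ω) ∂μ ≤ C) :
    Integrable (fun ω => f ((fun l => σ l ω), fun l => ξ l ω)) μ := by
  have hp := h.measurable_sigma_vec.prodMk h.measurable_xi_vec
  have : IsProbabilityMeasure (μ.map fun ω l => σ l ω) :=
    Measure.isProbabilityMeasure_map h.measurable_sigma_vec.aemeasurable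
  have : IsProbabilityMeasure (μ.map fun ω l => ξ l ω) :=
    Measure.isProbabilityMeasure_map h.measurable_xi_vec.aemeasurable
  have key : Integrable f (μ.map (fun ω => ((fun l => σ l ω), fun l => ξ l ω))) := by
    rw [h.map_sigma_xi, integrable_prod_iff hf.aestronglyMeasurable]
    have hfs : ∀ s, AEStronglyMeasurable (fun y => f (s, y)) (μ.map fun ω l => ξ l ω) :=
      fun s => (hf.comp measurable_prodMk_left).aestronglyMeasurable
    constructor
    · filter_upwards [h.ae_admissible] with s hs
      exact (integrable_map_measure (hfs s) h.measurable_xi_vec.aemeasurable).mpr (hint s hs)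
    · refine Integrable.of_bound (C := C)
        hf.norm.stronglyMeasurable.integral_prod_right.aestronglyMeasurable ?_
      filter_upwards [h.ae_admissible] with s hs
      have e : ∀ y, ‖f (s, y)‖ = f (s, y) := fun y => Real.norm_of_nonneg (h0 _)
      simp only [e]
      rw [Real.norm_of_nonneg (integral_nonneg fun y => h0 _), integral_map
        h.measurable_xi_vec.aemeasurable (hfs s)]
      exact hC s hs
  exact (integrable_map_measure hf.aestronglyMeasurable hp.aemeasurable).mp key

theorem integrable_loss (h : NoiseModel μ n σ ξ σs ξs) (hn : Odd n) (S : ℝ → ℝ) (lam : Fin n → ℝ) :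
    Integrable (fun ω => loss n S (obs n S σ ξ ω) lam) μ := by
  have hl : ∀ l, MemLp (fun ω => σ l ω * ξ l ω) 2 μ := by
    intro l
    have hm : AEStronglyMeasurable (fun ω => σ l ω * ξ l ω) μ :=
      ((h.measurable_sigma l).mul (h.measurable_xi l)).aestronglyMeasurable
    refine MemLp.of_le_mul (c := √σs) (h.memLp_two l) hm ?_
    filter_upwards [h.sigma_sq_le] with ω hω
    rw [norm_mul]
    exact mul_le_mul_of_nonneg_right (Real.abs_le_sqrt (hω l)) (norm_nonneg _)
  have hth : ∀ j, MemLp (fun ω => thetaHat n (obs n S σ ξ ω) j) 2 μ := by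
    intro j
    have hy : ∀ l, MemLp (fun ω => obs n S σ ξ ω l) 2 μ := fun l =>
      (memLp_const (S (design n l))).add (hl l)
    have hsum : MemLp (fun ω => ∑ l, basisFn n j (design n l) * obs n S σ ξ ω l) 2 μ :=
      memLp_sum_mul _ (fun l _ => hy l) _
    have e : (fun ω => thetaHat n (obs n S σ ξ ω) j)
        = fun ω => 1 / (n : ℝ) * ∑ l, basisFn n j (design n l) * obs n S σ ξ ω l := by
      funext ω
      simp only [thetaHat, mul_comm (basisFn n j _)]
    rw [e]
    exact hsum.const_mul _
  simp only [loss_eq_sum hn]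
  refine integrable_finsetSum _ fun j _ => ?_
  exact (((hth j).const_mul (lam j)).sub (memLp_const _)).integrable_sq

theorem integrable_pathRemainder (h : NoiseModel μ n σ ξ σs ξs) {d : ℕ} (hn : Odd n)
    (hσs : 0 ≤ σs) {s : Fin n → ℝ} (hs : ∀ l, s l ^ 2 ≤ σs) {S : ℝ → ℝ} {r : ℝ} (hr : 0 ≤ r)
    (hS : S ∈ sobolevBall 1 r) (hd : 1 ≤ d) (Λ : Finset (Fin n → ℝ)) (ρ u v : ℝ)
    (lam₀ : Fin n → ℝ) :
    Integrable (fun ω => pathRemainder n d Λ ρ σs u v S lam₀ s fun l => ξ l ω) μ := by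
  have hV := (h.integral_abs_meanVar_sub_varEst_le hn hσs hs hr hS hd).1
  unfold pathRemainder
  refine (integrable_finsetSum _ fun lam _ => h.integrable_crossRemainder ρ s _ _).add
    (Integrable.const_mul ?_ _)
  refine ((((integrable_const _).add
    (((h.memLp_diagTerm _ s).integrable (by norm_num)).abs.const_mul _)).add
    ((integrable_finsetSum _ fun lam _ =>
      ((h.memLp_diagTerm _ s).integrable (by norm_num)).abs).const_mul _)).add
    ((integrable_finsetSum _ fun lam _ => ?_).const_mul _)).add (hV.const_mul _)
  exact (h.memLp_bilinTerm lam s).integrable_sq.div_const _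

theorem integral_pathRemainder_le (h : NoiseModel μ n σ ξ σs ξs) {d : ℕ} (hn : Odd n)
    (hσs : 0 ≤ σs) {s : Fin n → ℝ} (hs : ∀ l, s l ^ 2 ≤ σs) {S : ℝ → ℝ} {r : ℝ} (hr : 0 ≤ r)
    (hS : S ∈ sobolevBall 1 r) (hd : 1 ≤ d) {Λ : Finset (Fin n → ℝ)}
    (hΛ : ∀ lam ∈ Λ, ∀ j, lam j ∈ Icc (0 : ℝ) 1) {ρ u v : ℝ} (hρ : 0 < ρ) (hρ1 : ρ ≤ 1)
    (hu0 : 0 ≤ u) (hv0 : 0 ≤ v) (hu : ∀ lam ∈ Λ, ∀ l, |basisDev 1 n lam l| ≤ u)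
    {lam₀ : Fin n → ℝ} (h0 : lam₀ ∈ Λ) :
    ∫ ω, pathRemainder n d Λ ρ σs u v S lam₀ s (fun l => ξ l ω) ∂μ
      ≤ Λ.card * (2 * σs / (ρ * n)) + (1 - ρ) * (4 * (u * σs / n)
        + 2 * v * (σs * (√ξs / √n) / n) + 4 * (Λ.card * (u * σs * (√ξs / √n) / n))
        + 2 * (Λ.card * (4 * σs / (ρ * n)))
        + (2 + 2 * ρ) * (v / n) * (2 * ((2 * (√ξs + √2) * σs + varStar n d σs r) / √n))) := by
  have hn0 : (0 : ℝ) < n := by exact_mod_cast hn.pos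
  obtain ⟨hV, hVle⟩ := h.integral_abs_meanVar_sub_varEst_le hn hσs hs hr hS hd
  have k1 := fun (lam : Fin n → ℝ) (_ : lam ∈ Λ) =>
    h.integrable_crossRemainder ρ s (fun l => S (design n l)) (fun j => lam j - lam₀ j)
  have k2 := ((h.memLp_diagTerm (fun _ => 1) s).integrable (by norm_num)).abs.const_mul (2 * v)
  have k3 := fun (lam : Fin n → ℝ) (_ : lam ∈ Λ) =>
    ((h.memLp_diagTerm (basisDev 1 n lam) s).integrable (by norm_num)).abs
  have k4 := fun (lam : Fin n → ℝ) (_ : lam ∈ Λ) =>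
    (h.memLp_bilinTerm lam s).integrable_sq.div_const (ρ * truePenalty n s lam)
  have k3' := (integrable_finsetSum _ k3).const_mul 4
  have k4' := (integrable_finsetSum _ k4).const_mul 2
  have k5 := hV.const_mul ((2 + 2 * ρ) * (v / n))
  have kc : Integrable (fun _ : Ω => 4 * (u * σs / n)) μ := integrable_const _
  simp only [pathRemainder]
  rw [integral_add (integrable_finsetSum _ k1) (((((kc.fun_add k2).fun_add k3').fun_add k4').fun_add
    k5).const_mul _), integral_const_mul,
    integral_add (((kc.fun_add k2).fun_add k3').fun_add k4') k5,
    integral_add ((kc.fun_add k2).fun_add k3') k4', integral_add (kc.fun_add k2) k3',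
    integral_add kc k2, integral_finsetSum _ k1, integral_const_mul, integral_const_mul,
    integral_const_mul, integral_const_mul, integral_finsetSum _ k3, integral_finsetSum _ k4,
    integral_const_mul, integral_const]
  simp only [probReal_univ, one_smul]
  have hsum : ∀ (f : (Fin n → ℝ) → ℝ) (C : ℝ), (∀ lam ∈ Λ, f lam ≤ C) →
      ∑ lam ∈ Λ, f lam ≤ Λ.card * C := by
    intro f C hC
    refine (Finset.sum_le_sum hC).trans_eq ?_
    rw [Finset.sum_const, nsmul_eq_mul]
  have b1 := hsum _ _ fun lam hlam => h.integral_crossRemainder_le hn hσs hs hρ hρ1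
    (fun l => S (design n l)) (c := fun j => lam j - lam₀ j) fun j => by
      have h1 := hΛ lam hlam j
      have h2 := hΛ lam₀ h0 j
      rw [abs_le]
      constructor <;> linarith [h1.1, h1.2, h2.1, h2.2]
  have b2 := h.integral_abs_diagTerm_le hn hσs hs (w := fun _ => 1) zero_le_one (by simp)
  rw [one_mul] at b2
  have b3 := hsum _ _ fun lam hlam => h.integral_abs_diagTerm_le hn hσs hs hu0 (hu lam hlam)
  have b4 := hsum
    (fun lam => ∫ ω, (bilinTerm n lam s fun l => ξ l ω) ^ 2 / (ρ * truePenalty n s lam) ∂μ)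
    (4 * σs / (ρ * n)) fun lam _ => by
      rw [integral_div]
      refine div_le_of_le_mul₀ (mul_nonneg hρ.le (truePenalty_nonneg _ _ _)) (by positivity)
        ((h.integral_bilinTerm_sq_le hn hσs hs lam).trans_eq ?_)
      field_simp
  have hρ' : 0 ≤ 1 - ρ := by linarith
  gcongr

end NoiseModel

/-! ### The oracle inequality -/

theorem abs_basisDev_le_uMax (i : ℕ) {n : ℕ} {Λ : Finset (Fin n → ℝ)} {lam : Fin n → ℝ}
    (h : lam ∈ Λ) (l : Fin n) : |basisDev i n lam l| ≤ uMax i n Λ := by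
  have h1 : |basisDev i n lam l| ≤ ⨆ l : Fin n, |basisDev i n lam l| :=
    le_ciSup (f := fun l => |basisDev i n lam l|) (Set.finite_range _).bddAbove l
  exact h1.trans (le_ciSup (f := fun lam : Λ => ⨆ l : Fin n, |basisDev i n lam.1 l|)
    (Set.finite_range _).bddAbove ⟨lam, h⟩)

theorem uMax_nonneg (i n : ℕ) (Λ : Finset (Fin n → ℝ)) : 0 ≤ uMax i n Λ :=
  Real.iSup_nonneg fun _ => Real.iSup_nonneg fun _ => abs_nonneg _

theorem sum_le_vMax {n : ℕ} {Λ : Finset (Fin n → ℝ)} {lam : Fin n → ℝ} (h : lam ∈ Λ) :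
    ∑ j, lam j ≤ vMax n Λ :=
  le_ciSup (f := fun lam : Λ => ∑ j, lam.1 j) (Set.finite_range _).bddAbove ⟨lam, h⟩

theorem vMax_nonneg {n : ℕ} {Λ : Finset (Fin n → ℝ)}
    (hΛ : ∀ lam ∈ Λ, ∀ j, lam j ∈ Icc (0 : ℝ) 1) : 0 ≤ vMax n Λ :=
  Real.iSup_nonneg fun lam => Finset.sum_nonneg fun j _ => (hΛ lam.1 lam.2 j).1

theorem integrated_remainder_le {n d : ℕ} (hn : 0 < n) {Λ : Finset (Fin n → ℝ)}
    (hne : Λ.Nonempty) {σs ξs ρ r v : ℝ} (hv : v = vMax n Λ) (hv0 : 0 ≤ v) (hσs : 0 ≤ σs)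
    (hρ : 0 < ρ) (hρ3 : ρ < 1 / 3) :
    2 * ρ * (1 - ρ) * (uMax 2 n Λ * σs / n)
      + (Λ.card * (2 * σs / (ρ * n)) + (1 - ρ) * (4 * (uMax 1 n Λ * σs / n)
        + 2 * v * (σs * (√ξs / √n) / n) + 4 * (Λ.card * (uMax 1 n Λ * σs * (√ξs / √n) / n))
        + 2 * (Λ.card * (4 * σs / (ρ * n)))
        + (2 + 2 * ρ) * (v / n) * (2 * ((2 * (√ξs + √2) * σs + varStar n d σs r) / √n))))
      ≤ (1 - 3 * ρ) * (1 / n * remainder n d Λ σs ξs ρ r) := by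
  have hn0 : (0 : ℝ) < n := by exact_mod_cast hn
  have hcard : (1 : ℝ) ≤ Λ.card := by exact_mod_cast hne.card_pos
  have h3 : 1 - 3 * ρ ≠ 0 := by linarith
  have hq : (0 : ℝ) < √n := Real.sqrt_pos.mpr hn0
  rw [← sub_nonneg]
  -- All contributions cancel except twofold slack in the bilinear term and 4ν against 2 in the
  -- diagonal term; the latter is nonnegative because ν ≥ 1.
  have key : (1 - 3 * ρ) * (1 / n * remainder n d Λ σs ξs ρ r)
      - (2 * ρ * (1 - ρ) * (uMax 2 n Λ * σs / n)
      + (Λ.card * (2 * σs / (ρ * n)) + (1 - ρ) * (4 * (uMax 1 n Λ * σs / n)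
        + 2 * v * (σs * (√ξs / √n) / n) + 4 * (Λ.card * (uMax 1 n Λ * σs * (√ξs / √n) / n))
        + 2 * (Λ.card * (4 * σs / (ρ * n)))
        + (2 + 2 * ρ) * (v / n) * (2 * ((2 * (√ξs + √2) * σs + varStar n d σs r) / √n)))))
      = (1 - ρ) * (8 * Λ.card * σs / ρ + (4 * Λ.card - 2) * v * σs * (√ξs / √n)) / n := by
    rw [remainder, psi, upsilonStar, kappa, ← hv]
    generalize varStar n d σs r = V
    generalize √(n : ℝ) = q at hq ⊢
    field_simp
    ring
  rw [key]
  have h1 : 0 ≤ 1 - ρ := by linarith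
  have h2 : 0 ≤ 4 * (Λ.card : ℝ) - 2 := by linarith
  positivity

theorem oracle_inequality {n d : ℕ} (hn : Odd n) (hd : 1 ≤ d) {r σs ξs : ℝ} (hr : 0 < r)
    (hσs : 0 < σs) {Λ : Finset (Fin n → ℝ)} (hΛ : ∀ lam ∈ Λ, ∀ j, lam j ∈ Icc (0 : ℝ) 1)
    {ρ : ℝ} (hρ : 0 < ρ) (hρ3 : ρ < 1 / 3) {Ω : Type*} [MeasurableSpace Ω] {μ : Measure Ω}
    [IsProbabilityMeasure μ] {S : ℝ → ℝ} {σ ξ : Fin n → Ω → ℝ} {lamHat : Ω → Fin n → ℝ}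
    (hS : S ∈ sobolevBall 1 r) (h : NoiseModel μ n σ ξ σs ξs)
    (hint : Integrable (fun ω => loss n S (obs n S σ ξ ω) (lamHat ω)) μ)
    (hhat : ∀ ω, lamHat ω ∈ Λ ∧ ∀ lam ∈ Λ,
      cost n d ρ (obs n S σ ξ ω) (lamHat ω) ≤ cost n d ρ (obs n S σ ξ ω) lam)
    {lam₀ : Fin n → ℝ} (h0 : lam₀ ∈ Λ) :
    ∫ ω, loss n S (obs n S σ ξ ω) (lamHat ω) ∂μ ≤
      (1 + 3 * ρ - 2 * ρ ^ 2) / (1 - 3 * ρ) * (∫ ω, loss n S (obs n S σ ξ ω) lam₀ ∂μ)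
        + 1 / (n : ℝ) * remainder n d Λ σs ξs ρ r := by
  set u := uMax 1 n Λ with hu
  set v := vMax n Λ with hv
  have hu0 : 0 ≤ u := uMax_nonneg _ _ _
  have hv0 : 0 ≤ v := vMax_nonneg hΛ
  have h13 : 0 < 1 - 3 * ρ := by linarith
  have hG := measurable_pathRemainder n d Λ ρ σs u v S lam₀
  have hub : ∀ lam ∈ Λ, ∀ l, |basisDev 1 n lam l| ≤ u := fun lam hlam =>
    abs_basisDev_le_uMax 1 hlam
  have hGle := fun s (hs : s ∈ admissible n σs) => h.integral_pathRemainder_le hn hσs.le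
    (fun l => (hs l).2) hr.le hS hd hΛ hρ (by linarith) hu0 hv0 hub h0
  have hGI : Integrable (fun ω => pathRemainder n d Λ ρ σs u v S lam₀
      (fun l => σ l ω) fun l => ξ l ω) μ := by
    refine h.integrable_of_forall_admissible hG (fun p => ?_)
      (fun s hs => h.integrable_pathRemainder hn hσs.le (fun l => (hs l).2) hr.le hS hd Λ ρ u v
        lam₀) hGle
    have hn0 : (0 : ℝ) ≤ n := Nat.cast_nonneg n
    have hρ1 : 0 ≤ 1 - ρ := by linarith
    have b1 : 0 ≤ ∑ lam ∈ Λ, crossRemainder n ρ (fun l => S (design n l))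
        (fun l => p.1 l * p.2 l) (fun j => lam j - lam₀ j) :=
      Finset.sum_nonneg fun lam _ => crossRemainder_nonneg hρ _ _ _
    have b2 : 0 ≤ ∑ lam ∈ Λ, |diagTerm n (basisDev 1 n lam) p.1 p.2| :=
      Finset.sum_nonneg fun lam _ => abs_nonneg _
    have b3 : 0 ≤ ∑ lam ∈ Λ, bilinTerm n lam p.1 p.2 ^ 2 / (ρ * truePenalty n p.1 lam) :=
      Finset.sum_nonneg fun lam _ =>
        div_nonneg (sq_nonneg _) (mul_nonneg hρ.le (truePenalty_nonneg _ _ _))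
    unfold pathRemainder
    positivity
  have hGint := h.integral_le_of_forall_admissible hG hGI hGle
  simp only at hGint
  have hA0 := h.integrable_loss hn S lam₀
  have hPI : Integrable (fun ω => truePenalty n (fun l => σ l ω) lam₀) μ := by
    refine Integrable.of_bound (C := (∑ j, lam₀ j ^ 2) * σs / n)
      ((measurable_truePenalty n lam₀).comp h.measurable_sigma_vec).aestronglyMeasurable ?_
    filter_upwards [h.sigma_sq_le] with ω hω
    rw [Real.norm_of_nonneg (truePenalty_nonneg _ _ _)]
    refine div_le_div_of_nonneg_right (mul_le_mul_of_nonneg_left (meanVar_le hn.pos hω) ?_)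
      (Nat.cast_nonneg n)
    exact Finset.sum_nonneg fun j _ => sq_nonneg _
  have hPA : ∫ ω, (truePenalty n (fun l => σ l ω) lam₀ - loss n S (obs n S σ ξ ω) lam₀) ∂μ
      ≤ uMax 2 n Λ * σs / n := by
    have hu2 := fun l => abs_basisDev_le_uMax 2 h0 l
    have hy : Measurable fun p : (Fin n → ℝ) × (Fin n → ℝ) =>
        fun l => S (design n l) + p.1 l * p.2 l := by fun_prop
    have hf : Measurable fun p : (Fin n → ℝ) × (Fin n → ℝ) => truePenalty n p.1 lam₀
        - loss n S (fun l => S (design n l) + p.1 l * p.2 l) lam₀ :=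
      ((measurable_truePenalty n lam₀).comp measurable_fst).sub
        (measurable_loss n S hy measurable_const)
    have hle := fun s (hs : s ∈ admissible n σs) =>
      h.integral_truePenalty_sub_loss_le hn (fun l => (hs l).2) S hu2
    exact h.integral_le_of_forall_admissible hf (hPI.sub hA0) hle
  -- The loss of λ₀ is added and subtracted 2ρ(1 - ρ) times: (1 + ρ) + 2ρ(1 - ρ) = 1 + 3ρ - 2ρ².
  have hpath : ∀ᵐ ω ∂μ, (1 - 3 * ρ) * loss n S (obs n S σ ξ ω) (lamHat ω)
      ≤ (1 + 3 * ρ - 2 * ρ ^ 2) * loss n S (obs n S σ ξ ω) lam₀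
        + (2 * ρ * (1 - ρ) * (truePenalty n (fun l => σ l ω) lam₀
            - loss n S (obs n S σ ξ ω) lam₀)
          + pathRemainder n d Λ ρ σs u v S lam₀ (fun l => σ l ω) fun l => ξ l ω) := by
    filter_upwards [h.sigma_pos, h.sigma_sq_le] with ω hω1 hω2
    have := oracle_pathwise (y := obs n S σ ξ ω) hn hΛ hρ hρ3 hub (fun lam hlam => sum_le_vMax hlam)
      S (s := fun l => σ l ω) (x := fun l => ξ l ω) rfl hω1 hω2 h0 (hhat ω).1 ((hhat ω).2 lam₀ h0)
    refine this.trans_eq ?_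
    ring
  have hPAI : Integrable (fun ω => truePenalty n (fun l => σ l ω) lam₀
      - loss n S (obs n S σ ξ ω) lam₀) μ := hPI.sub hA0
  have j1 := hA0.const_mul (1 + 3 * ρ - 2 * ρ ^ 2)
  have j2 := hPAI.const_mul (2 * ρ * (1 - ρ))
  have hmono := integral_mono_ae (hint.const_mul (1 - 3 * ρ)) (j1.fun_add (j2.fun_add hGI)) hpath
  rw [integral_const_mul, integral_add j1 (j2.fun_add hGI), integral_add j2 hGI,
    integral_const_mul, integral_const_mul] at hmono
  have hnum := integrated_remainder_le (d := d) (ξs := ξs) (r := r) hn.pos ⟨lam₀, h0⟩ hv hv0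
    hσs.le hρ hρ3
  have hPA' := mul_le_mul_of_nonneg_left hPA (by nlinarith : 0 ≤ 2 * ρ * (1 - ρ))
  have hfin : (1 - 3 * ρ) * ∫ ω, loss n S (obs n S σ ξ ω) (lamHat ω) ∂μ
      ≤ (1 - 3 * ρ) * ((1 + 3 * ρ - 2 * ρ ^ 2) / (1 - 3 * ρ)
        * (∫ ω, loss n S (obs n S σ ξ ω) lam₀ ∂μ) + 1 / (n : ℝ) * remainder n d Λ σs ξs ρ r) := by
    have e : ∀ X Y : ℝ, (1 - 3 * ρ) * ((1 + 3 * ρ - 2 * ρ ^ 2) / (1 - 3 * ρ) * X + Y)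
        = (1 + 3 * ρ - 2 * ρ ^ 2) * X + (1 - 3 * ρ) * Y := by
      intro X Y
      field_simp
    rw [e]
    linarith
  exact le_of_mul_le_mul_left hfin h13

/-- The loss at the random choice is dominated by the sum of the losses over the finite family. -/
theorem integrable_loss_of_mem {n : ℕ} (hn : Odd n) {σs ξs : ℝ} {Λ : Finset (Fin n → ℝ)}
    {Ω : Type*} [MeasurableSpace Ω] {μ : Measure Ω} [IsProbabilityMeasure μ] (S : ℝ → ℝ)
    {σ ξ : Fin n → Ω → ℝ} {lamHat : Ω → Fin n → ℝ} (h : NoiseModel μ n σ ξ σs ξs)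
    (hm : Measurable lamHat) (hhat : ∀ ω, lamHat ω ∈ Λ) :
    Integrable (fun ω => loss n S (obs n S σ ξ ω) (lamHat ω)) μ := by
  have hnn : ∀ y lam, 0 ≤ loss n S y lam := fun y lam =>
    mul_nonneg (by positivity) (Finset.sum_nonneg fun l _ => sq_nonneg _)
  have hobs : Measurable fun ω => obs n S σ ξ ω := by
    refine measurable_pi_lambda _ fun l => ?_
    exact measurable_const.add ((h.measurable_sigma l).mul (h.measurable_xi l))
  have hmeas : Measurable fun ω => loss n S (obs n S σ ξ ω) (lamHat ω) :=
    measurable_loss n S hobs hm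
  refine Integrable.mono' (integrable_finsetSum Λ fun lam _ => h.integrable_loss hn S lam)
    hmeas.aestronglyMeasurable (Eventually.of_forall fun ω => ?_)
  rw [Real.norm_of_nonneg (hnn _ _)]
  have hsingle : ∀ f : (Fin n → ℝ) → ℝ, (∀ lam, 0 ≤ f lam) → ∀ lam ∈ Λ, f lam ≤ ∑ lam ∈ Λ, f lam :=
    fun f hf lam hlam => Finset.single_le_sum (fun i _ => hf i) hlam
  exact hsingle (fun lam => loss n S (obs n S σ ξ ω) lam) (hnn _) _ (hhat ω)

/-! ### The size of the remainder -/

theorem tendsto_natCast_rpow_oddAtTop {γ : ℝ} (hγ : 0 < γ) :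
    Tendsto (fun n : ℕ => (n : ℝ) ^ γ) oddAtTop atTop :=
  ((tendsto_rpow_atTop hγ).comp tendsto_natCast_atTop_atTop).mono_left inf_le_left

namespace SlowlyGrowing

theorem add {a b : ℕ → ℝ} (ha : SlowlyGrowing a) (hb : SlowlyGrowing b) :
    SlowlyGrowing fun n => a n + b n := by
  intro γ hγ
  simpa only [add_div, add_zero] using (ha γ hγ).add (hb γ hγ)

/-- Each factor receives half of the exponent. -/
theorem mul {a b : ℕ → ℝ} (ha : SlowlyGrowing a) (hb : SlowlyGrowing b) :
    SlowlyGrowing fun n => a n * b n := by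
  intro γ hγ
  have := (ha (γ / 2) (by linarith)).mul (hb (γ / 2) (by linarith))
  rw [mul_zero] at this
  refine this.congr fun n => ?_
  rw [div_mul_div_comm, ← sq, ← Real.rpow_mul_natCast (Nat.cast_nonneg n)]
  norm_num

theorem of_tendsto {a : ℕ → ℝ} {c : ℝ} (ha : Tendsto a oddAtTop (𝓝 c)) : SlowlyGrowing a :=
  fun _ hγ => ha.div_atTop (tendsto_natCast_rpow_oddAtTop hγ)

theorem const (c : ℝ) : SlowlyGrowing fun _ => c := of_tendsto tendsto_const_nhds

theorem const_mul {a : ℕ → ℝ} (c : ℝ) (ha : SlowlyGrowing a) : SlowlyGrowing fun n => c * a n :=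
  (const c).mul ha

theorem inv_of_slowlyDecreasing {ϱ : ℕ → ℝ} (h : SlowlyDecreasing ϱ) :
    SlowlyGrowing fun n => (ϱ n)⁻¹ := by
  intro γ hγ
  refine (tendsto_inv_atTop_zero.comp (h.2 γ hγ)).congr fun n => ?_
  simp only [Function.comp, mul_inv]
  rw [div_eq_mul_inv, mul_comm]

end SlowlyGrowing

theorem remainder_nonneg {n d : ℕ} {Λ : Finset (Fin n → ℝ)}
    (hΛ : ∀ lam ∈ Λ, ∀ j, lam j ∈ Icc (0 : ℝ) 1) {σs ξs ρ r : ℝ} (hσs : 0 ≤ σs) (hr : 0 ≤ r)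
    (hρ : 0 < ρ) (hρ6 : ρ ≤ 1 / 6) : 0 ≤ remainder n d Λ σs ξs ρ r := by
  have h1 : 0 ≤ 1 - ρ := by linarith
  have h3 : 0 ≤ 1 - 3 * ρ := by linarith
  have h2 : 0 ≤ 1 - ρ ^ 2 := by nlinarith
  have u1 := uMax_nonneg 1 n Λ
  have u2 := uMax_nonneg 2 n Λ
  have hv := vMax_nonneg hΛ
  unfold remainder psi upsilonStar kappa varStar
  positivity

/-- On ρ ≤ 1/6 one has 1 - 3ρ ≥ 1/2, which gives κ(ρ) ≤ 8, and the only singularity, 1/ρ, is bounded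
at the left endpoint τ. The constant 36 is 2 · 16 from Υ* plus 4 from the term 2ν. -/
theorem remainder_le {n d : ℕ} (hn : 1 ≤ n) (hd : 1 ≤ d) {Λ : Finset (Fin n → ℝ)}
    (hΛ : ∀ lam ∈ Λ, ∀ j, lam j ∈ Icc (0 : ℝ) 1) {σs ξs ρ r τ C : ℝ} (hσs : 0 ≤ σs)
    (hr : 0 ≤ r) (hτ : 0 < τ) (hτρ : τ ≤ ρ) (hρ6 : ρ ≤ 1 / 6) (hC : vMax n Λ / √n ≤ C) :
    remainder n d Λ σs ξs ρ r ≤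
      σs * (36 * (Λ.card * τ⁻¹) + 8 * uMax 1 n Λ + 8 * √ξs * (uMax 1 n Λ * Λ.card)
        + 8 * √ξs * C * Λ.card + uMax 2 n Λ)
      + 8 * C * (2 * (√ξs + √2) * σs + 4 * r * (√n / d ^ 2) + 4 * √(r * σs) + 2 * σs
        + σs * (d / √n)) := by
  have hρ : 0 < ρ := hτ.trans_le hτρ
  have h3 : 0 < 1 - 3 * ρ := by linarith
  have u1 := uMax_nonneg 1 n Λ
  have u2 := uMax_nonneg 2 n Λ
  have hv := vMax_nonneg hΛ
  have hq1 : 1 ≤ √(n : ℝ) := Real.one_le_sqrt.mpr (by exact_mod_cast hn)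
  have hq : 0 < √(n : ℝ) := by linarith
  have hd1 : (1 : ℝ) ≤ d := by exact_mod_cast hd
  have hw : 0 ≤ vMax n Λ / √n := div_nonneg hv hq.le
  have hC0 : 0 ≤ C := hw.trans hC
  set ν : ℝ := (Λ.card : ℝ) with hν
  have hν0 : 0 ≤ ν := Nat.cast_nonneg _
  have hx := Real.sqrt_nonneg ξs
  have hkappa : kappa ρ ≤ 8 := by
    rw [kappa, div_le_iff₀ h3]
    nlinarith
  have hkappa0 : 0 ≤ kappa ρ := div_nonneg (by nlinarith) h3.le
  have hvar : varStar n d σs r ≤ 4 * r * (√n / d ^ 2) + 4 * √(r * σs) + 2 * σs + σs * (d / √n) := by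
    have e1 : 4 * √(r * σs) * (1 / (d : ℝ)) ≤ 4 * √(r * σs) := by
      refine mul_le_of_le_one_right (by positivity) ?_
      rw [div_le_one (by linarith)]
      exact hd1
    have e2 : (2 + (d : ℝ)) * σs / √n = 2 * σs / √n + σs * (d / √n) := by ring
    have e3 : 2 * σs / √n ≤ 2 * σs := div_le_self (by positivity) hq1
    have e4 : 4 * r * √(n : ℝ) / (d : ℝ) ^ 2 = 4 * r * (√n / d ^ 2) := by ring
    rw [varStar, e2, e4]
    linarith
  have hvar0 : 0 ≤ varStar n d σs r := by unfold varStar; positivity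
  have hinv : ρ⁻¹ ≤ τ⁻¹ := inv_anti₀ hτ hτρ
  have hups : upsilonStar n Λ ξs ρ ≤ 16 * (ν * τ⁻¹) + 4 * uMax 1 n Λ
      + 4 * √ξs * (uMax 1 n Λ * ν) + 4 * √ξs * C * ν := by
    have e1 : √ξs / √(n : ℝ) ≤ √ξs := div_le_self hx hq1
    have e2 : 4 * ν * vMax n Λ * (√ξs / √(n : ℝ)) ≤ 4 * √ξs * C * ν := by
      have : 4 * ν * vMax n Λ * (√ξs / √(n : ℝ)) = 4 * ν * √ξs * (vMax n Λ / √n) := by ring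
      have := mul_le_mul_of_nonneg_left hC (by positivity : 0 ≤ 4 * ν * √ξs)
      linarith
    have e3 : 4 * uMax 1 n Λ * (1 + ν * (√ξs / √(n : ℝ)))
        ≤ 4 * uMax 1 n Λ * (1 + ν * √ξs) := by gcongr
    have e4 : 16 * ν / ρ ≤ 16 * (ν * τ⁻¹) := by
      rw [div_eq_mul_inv, mul_assoc]
      gcongr
    rw [upsilonStar, ← hν]
    linarith
  have hups0 : 0 ≤ upsilonStar n Λ ξs ρ := by
    unfold upsilonStar
    positivity
  have hpsi : psi n Λ σs ξs ρ ≤ (2 * upsilonStar n Λ ξs ρ + 4 * (ν * τ⁻¹) + uMax 2 n Λ) * σs := by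
    rw [psi]
    refine mul_le_mul_of_nonneg_right ?_ hσs
    rw [div_le_iff₀ (mul_pos hρ h3), ← hν]
    have f1 : ρ * (1 - ρ) * upsilonStar n Λ ξs ρ
        ≤ 2 * upsilonStar n Λ ξs ρ * (ρ * (1 - 3 * ρ)) := by
      have g1 : 1 - ρ ≤ 2 * (1 - 3 * ρ) := by linarith
      have g2 := mul_le_mul_of_nonneg_right (mul_le_mul_of_nonneg_left g1 hρ.le) hups0
      linarith
    have f2 : 2 * ν ≤ 4 * (ν * τ⁻¹) * (ρ * (1 - 3 * ρ)) := by
      have g1 : 1 ≤ τ⁻¹ * ρ := by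
        rw [inv_mul_eq_div, one_le_div hτ]
        exact hτρ
      have g2 := mul_le_mul g1 (by linarith : 1 / 2 ≤ 1 - 3 * ρ) (by norm_num) (by positivity)
      have g3 := mul_le_mul_of_nonneg_left g2 (by positivity : 0 ≤ 4 * ν)
      linarith
    have f3 : 2 * ρ ^ 2 * (1 - ρ) * uMax 2 n Λ ≤ uMax 2 n Λ * (ρ * (1 - 3 * ρ)) := by
      have g1 : 2 * ρ * (1 - ρ) ≤ 1 - 3 * ρ := by nlinarith only [hρ, hρ6]
      have g2 := mul_le_mul_of_nonneg_right (mul_le_mul_of_nonneg_left g1 hρ.le) u2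
      linarith
    linarith
  have hpsi' := hpsi.trans (mul_le_mul_of_nonneg_right (add_le_add_left (add_le_add_left
    (mul_le_mul_of_nonneg_left hups zero_le_two) _) _) hσs)
  have hsecond : kappa ρ * (2 * (√ξs + √2) * σs + varStar n d σs r) * (vMax n Λ / √n)
      ≤ 8 * (2 * (√ξs + √2) * σs + (4 * r * (√n / d ^ 2) + 4 * √(r * σs) + 2 * σs
        + σs * (d / √n))) * C := by
    gcongr
  rw [remainder]
  linarith

theorem tendsto_sSup_remainder {r σs ξs : ℝ} (hr : 0 < r) (hσs : 0 < σs)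
    {Λ : ∀ n : ℕ, Finset (Fin n → ℝ)}
    (hΛ : ∀ n, Odd n → 3 ≤ n → ∀ lam ∈ Λ n, ∀ j, lam j ∈ Icc (0 : ℝ) 1)
    {d : ℕ → ℕ} (hd : ∀ n, Odd n → 3 ≤ n → 1 ≤ d n ∧ d n ≤ n - 1)
    (hd1 : Tendsto (fun n => (d n : ℝ) / √(n : ℝ)) oddAtTop (𝓝 0))
    (hd2 : Tendsto (fun n => (d n : ℝ) ^ 2 / √(n : ℝ)) oddAtTop atTop)
    (hcard : SlowlyGrowing (fun n => ((Λ n).card : ℝ)))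
    (hv : (fun n => vMax n (Λ n)) =O[oddAtTop] (fun n => √(n : ℝ)))
    (hu1 : SlowlyGrowing (fun n => uMax 1 n (Λ n)))
    (hu2 : SlowlyGrowing (fun n => uMax 2 n (Λ n)))
    {ϱ : ℕ → ℝ} (hϱ : SlowlyDecreasing ϱ) {γ : ℝ} (hγ : 0 < γ) :
    (∀ᶠ n in oddAtTop, BddAbove
      ((fun ρ => remainder n (d n) (Λ n) σs ξs ρ r / (n : ℝ) ^ γ) '' Icc (ϱ n) (1 / 6))) ∧
    Tendsto (fun n => sSup
      ((fun ρ => remainder n (d n) (Λ n) σs ξs ρ r / (n : ℝ) ^ γ) '' Icc (ϱ n) (1 / 6)))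
      oddAtTop (𝓝 0) := by
  obtain ⟨C, hC⟩ := hv.bound
  have hodd : ∀ᶠ n in oddAtTop, Odd n := mem_inf_of_right (mem_principal_self _)
  have hge : ∀ᶠ n in oddAtTop, 3 ≤ n := mem_inf_of_left (eventually_ge_atTop 3)
  -- Slow decrease with exponent 1 forces ϱ_n to be eventually positive.
  have hpos : ∀ᶠ n in oddAtTop, 0 < ϱ n := by
    filter_upwards [(hϱ.2 1 one_pos).eventually_gt_atTop 0] with n hn
    exact pos_of_mul_pos_right hn (by positivity)
  let B : ℕ → ℝ := fun n =>
      σs * (36 * ((Λ n).card * (ϱ n)⁻¹) + 8 * uMax 1 n (Λ n)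
        + 8 * √ξs * (uMax 1 n (Λ n) * (Λ n).card)
        + 8 * √ξs * C * (Λ n).card + uMax 2 n (Λ n))
      + 8 * C * (2 * (√ξs + √2) * σs + 4 * r * (√(n : ℝ) / (d n : ℝ) ^ 2) + 4 * √(r * σs) + 2 * σs
        + σs * ((d n : ℝ) / √(n : ℝ)))
  have hB : SlowlyGrowing B := by
    have hd2' : Tendsto (fun n : ℕ => √(n : ℝ) / (d n : ℝ) ^ 2) oddAtTop (𝓝 0) :=
      (tendsto_inv_atTop_zero.comp hd2).congr fun n => by simp only [Function.comp, inv_div]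
    refine SlowlyGrowing.add (SlowlyGrowing.const_mul _ ?_) (SlowlyGrowing.const_mul _ ?_)
    · exact ((((hcard.mul (SlowlyGrowing.inv_of_slowlyDecreasing hϱ)).const_mul _).add
        (hu1.const_mul _)).add ((hu1.mul hcard).const_mul _)).add (hcard.const_mul _) |>.add hu2
    · exact ((((SlowlyGrowing.const _).add ((SlowlyGrowing.of_tendsto hd2').const_mul _)).add
        (SlowlyGrowing.const _)).add (SlowlyGrowing.const _)).add
        ((SlowlyGrowing.of_tendsto hd1).const_mul _)
  have hbound : ∀ᶠ n in oddAtTop, ∀ t ∈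
      (fun ρ => remainder n (d n) (Λ n) σs ξs ρ r / (n : ℝ) ^ γ) '' Icc (ϱ n) (1 / 6), 0 ≤ t ∧ t ≤ B n / (n : ℝ) ^ γ := by
    filter_upwards [hodd, hge, hpos, hC] with n h1 h3 hp hCn
    rintro t ⟨ρ, hρ, rfl⟩
    have hn0 : (0 : ℝ) < n := by exact_mod_cast h1.pos
    have hCn' : vMax n (Λ n) / √n ≤ C := by
      rw [div_le_iff₀ (Real.sqrt_pos.mpr hn0)]
      rw [Real.norm_of_nonneg (Real.sqrt_nonneg _)] at hCn
      exact (le_abs_self _).trans hCn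
    have hΛn := hΛ n h1 h3
    refine ⟨div_nonneg (remainder_nonneg hΛn hσs.le hr.le (hp.trans_le hρ.1) hρ.2)
      (by positivity), div_le_div_of_nonneg_right ?_ (by positivity)⟩
    exact remainder_le (by omega) (hd n h1 h3).1 hΛn hσs.le hr.le hp hρ.1 hρ.2 hCn'
  constructor
  · filter_upwards [hbound] with n hn
    exact ⟨_, fun t ht => (hn t ht).2⟩
  · have habs : Tendsto (fun n => |B n / (n : ℝ) ^ γ|) oddAtTop (𝓝 0) := by
      simpa using (hB γ hγ).abs
    refine squeeze_zero' ?_ ?_ habs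
    · filter_upwards [hbound] with n hn
      exact Real.sSup_nonneg fun t ht => (hn t ht).1
    · filter_upwards [hbound] with n hn
      exact Real.sSup_le (fun t ht => (hn t ht).2.trans (le_abs_self _)) (abs_nonneg _)

end HeteroReg

end


/-! ### The main theorem -/

theorem theorem2 (r σs ξs : ℝ) (hr : 0 < r) (hσs : 0 < σs)
    (Λ : ∀ n : ℕ, Finset (Fin n → ℝ))
    (hΛne : ∀ n, Odd n → 3 ≤ n → (Λ n).Nonempty)
    (hΛ : ∀ n, Odd n → 3 ≤ n → ∀ lam ∈ Λ n, ∀ j, lam j ∈ Icc (0 : ℝ) 1)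
    (d : ℕ → ℕ) (hd : ∀ n, Odd n → 3 ≤ n → 1 ≤ d n ∧ d n ≤ n - 1) :
    (∀ (n : ℕ), Odd n → 3 ≤ n → ∀ (ρ : ℝ), 0 < ρ → ρ < 1 / 3 →
      ∀ (Ω : Type*) [MeasurableSpace Ω] (μ : Measure Ω) [IsProbabilityMeasure μ]
        (S : ℝ → ℝ) (σ ξ : Fin n → Ω → ℝ) (lamHat : Ω → Fin n → ℝ),
        S ∈ sobolevBall 1 r →
        NoiseModel μ n σ ξ σs ξs →
        Measurable lamHat →
        (∀ ω, lamHat ω ∈ Λ n ∧ ∀ lam ∈ Λ n,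
          cost n (d n) ρ (obs n S σ ξ ω) (lamHat ω) ≤ cost n (d n) ρ (obs n S σ ξ ω) lam) →
        (∀ lam ∈ Λ n, Integrable (fun ω => loss n S (obs n S σ ξ ω) lam) μ) ∧
        Integrable (fun ω => loss n S (obs n S σ ξ ω) (lamHat ω)) μ ∧
        ∫ ω, loss n S (obs n S σ ξ ω) (lamHat ω) ∂μ ≤
          (1 + 3 * ρ - 2 * ρ ^ 2) / (1 - 3 * ρ) *
              (⨅ lam : Λ n, ∫ ω, loss n S (obs n S σ ξ ω) lam.1 ∂μ)
            + 1 / (n : ℝ) * remainder n (d n) (Λ n) σs ξs ρ r) ∧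
    (Tendsto (fun n => (d n : ℝ) / √(n : ℝ)) oddAtTop (𝓝 0) →
      Tendsto (fun n => (d n : ℝ) ^ 2 / √(n : ℝ)) oddAtTop atTop →
      SlowlyGrowing (fun n => ((Λ n).card : ℝ)) →
      (fun n => vMax n (Λ n)) =O[oddAtTop] (fun n => √(n : ℝ)) →
      SlowlyGrowing (fun n => uMax 1 n (Λ n)) →
      SlowlyGrowing (fun n => uMax 2 n (Λ n)) →
      ∀ ϱ : ℕ → ℝ, SlowlyDecreasing ϱ → ∀ γ : ℝ, 0 < γ →
        (∀ᶠ n in oddAtTop, BddAbove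
          ((fun ρ => remainder n (d n) (Λ n) σs ξs ρ r / (n : ℝ) ^ γ) '' Icc (ϱ n) (1 / 6))) ∧
        Tendsto (fun n => sSup
          ((fun ρ => remainder n (d n) (Λ n) σs ξs ρ r / (n : ℝ) ^ γ) '' Icc (ϱ n) (1 / 6)))
          oddAtTop (𝓝 0)) := by
  refine ⟨?_, fun h1 h2 h3 h4 h5 h6 ϱ hϱ γ hγ =>
    tendsto_sSup_remainder hr hσs hΛ hd h1 h2 h3 h4 h5 h6 hϱ hγ⟩
  intro n hn hn3 ρ hρ hρ3 Ω _ μ _ S σ ξ lamHat hS h hm hhat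
  have hint := integrable_loss_of_mem hn S h hm fun ω => (hhat ω).1
  refine ⟨fun lam _ => h.integrable_loss hn S lam, hint, ?_⟩
  have : Nonempty (Λ n) := (hΛne n hn hn3).to_subtype
  -- The infimum over the finite nonempty family is attained, so the inequality for one fixed λ₀
  -- suffices.
  obtain ⟨lam, hlam⟩ := exists_eq_ciInf_of_finite
    (f := fun lam : Λ n => ∫ ω, loss n S (obs n S σ ξ ω) lam.1 ∂μ)
  rw [← hlam]
  exact oracle_inequality hn (hd n hn hn3).1 hr hσs (hΛ n hn hn3) hρ hρ3 hS h hint hhat lam.2
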